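/- Let $\mathfrak Y$ be a Polish space with its Borel $\sigma$-field, and let $\mathfrak X=\mathfrak Y\cup\{\ast\}$ with $\ast\notin\mathfrak Y$, equipped with the $\sigma$-field generated by the measurable subsets of $\mathfrak Y$ and the point $\ast$. Write $Hf=\int f\,dH$. Let $g,q:\mathfrak Y\to\mathbb R$ be measurable; extend $g$, $e^q$, $ge^q$ (and $g^2e^{2q}$, $g^2$, $e^{2q}$) to $\mathfrak X$ by the value $0$ at $\ast$, and for a probability measure $H$ on $\mathfrak X$ set $$\chi(H,q)=\frac{H(ge^q)\,H\{\ast\}}{H(e^q)}+Hg .$$ Let $H_0$ be a probability measure on $\mathfrak X$ with $H_0\{\ast\}<1$ and let $a$ be a finite measure on $\mathfrak X$ such that $$(H_0+a)\bigl(g^2e^{2q}+g^2+e^{2q}\bigr)<\infty .$$ For $X_1,X_2,\ldots\in\mathfrak X$ let $\mathbb H_n=n^{-1}\sum_{i=1}^n\delta_{X_i}$, and suppose that for every $n\ge1$ the posterior law of $H$ is the Dirichlet process $H\mid X_1,\ldots,X_n\sim \mathrm{DP}(a+n\mathbb H_n)$, that is, for every finite measurable partition $A_1,\ldots,A_k$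 of $\mathfrak X$ the vector $(H(A_1),\ldots,H(A_k))$ has the Dirichlet distribution with parameters $(a+n\mathbb H_n)(A_i)$. **Theorem 3.1 (Bernstein–von Mises for $H$).** For every fixed such $q$, for $H_0^\infty$-almost every sequence $X_1,X_2,\ldots$, $$\sqrt n\bigl(\chi(H,q)-\chi(\mathbb H_n,q)\bigr)\,\big|\,X_1,\ldots,X_n\ \rightsquigarrow\ Z_{H_0},$$ $$Z_{H_0}=\frac{\mathbb B_{H_0}(1_{\{\ast\}})\,H_0(ge^q)}{H_0e^q}+\frac{H_0\{\ast\}\,\mathbb B_{H_0}(ge^q)}{H_0e^q}-\frac{H_0\{\ast\}\,H_0(ge^q)\,\mathbb B_{H_0}(e^q)}{(H_0e^q)^2}+\mathbb B_{H_0}g ,$$ where $\mathbb B_{H_0}$ is an $H_0$-Brownian bridge: a zero-mean Gaussian process indexed by the functions square-integrable under $H_0$, with $\operatorname{cov}(\mathbb B_{H_0}f,\mathbb B_{H_0}h)=H_0(fh)-H_0f\,H_0h$. Here $\rightsquigarrow$ means that the bounded Lipschitz distance $\sup_h\bigl|\int h\,d\mu_n-\mathbb E\,h(Z_{H_0})\bigr|$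 tends to $0$, where $\mu_n$ is the posterior law of $\sqrt n(\chi(H,q)-\chi(\mathbb H_n,q))$ given $X_1,\ldots,X_n$ and the supremum is over all $h:\mathbb R\to[-1,1]$ with Lipschitz constant at most $1$. The variable $Z_{H_0}$ is normal with mean $0$ and variance $H_0\psi^2-(H_0\psi)^2$ for $$\psi=\frac{H_0(ge^q)}{H_0e^q}1_{\{\ast\}}+\frac{H_0\{\ast\}}{H_0e^q}\,ge^q-\frac{H_0\{\ast\}H_0(ge^q)}{(H_0e^q)^2}\,e^q+g .$$ -/

import Mathlib

open MeasureTheory ProbabilityTheory Filter Topology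

noncomputable section

/-! ### Dirichlet distributions and the Dirichlet process -/

/-- The gamma distribution with shape `s ≥ 0` and scale `1`; shape `0` gives the point mass at `0`. -/
def gammaLaw (s : ℝ) : Measure ℝ :=
  if s = 0 then Measure.dirac 0 else gammaMeasure s 1

/-- The Dirichlet distribution with parameters `s i ≥ 0`, not all zero: the law of the vector
`(Y i / ∑ j, Y j)` for independent gamma variables `Y i` with shapes `s i`. -/
def dirichletLaw {k : ℕ} (s : Fin k → ℝ) : Measure (Fin k → ℝ) :=
  (Measure.pi fun i => gammaLaw (s i)).map fun y i => y i / ∑ j, y j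

/-- `D` is the law of a Dirichlet process with base measure `α`: a random probability measure `H`
such that, for every finite measurable partition `A 0, …, A (k - 1)` of the space, the vector
`(H (A 0), …, H (A (k - 1)))` has the Dirichlet distribution with parameters `α (A i)`. -/
def IsDirichletProcess {E : Type*} [MeasurableSpace E] (α : Measure E)
    (D : Measure (ProbabilityMeasure E)) : Prop :=
  ∀ (k : ℕ) (A : Fin k → Set E), (∀ i, MeasurableSet (A i)) →
    Pairwise (fun i j => Disjoint (A i) (A j)) → (⋃ i, A i) = Set.univ →
      D.map (fun (H : ProbabilityMeasure E) (i : Fin k) => (H : Measure E).real (A i)) =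
        dirichletLaw fun i => α.real (A i)

/-- The empirical measure of a sample of size `n` (for `n ≥ 1`). -/
def empiricalMeasure {E : Type*} [MeasurableSpace E] {n : ℕ} (x : Fin n → E) : Measure E :=
  (n : ENNReal)⁻¹ • ∑ i, Measure.dirac (x i)

/-! ### Brownian bridges and the bounded Lipschitz distance -/

/-- `B` is a `Q`-Brownian bridge process on the probability space `(Ω, P)`: its coordinates `B f`,
for `f` square-integrable under `Q`, form a zero-mean Gaussian process with
`cov (B f) (B h) = Q (f h) - Q f * Q h`. (Other coordinates are unconstrained.) -/
structure IsBrownianBridge {E Ω : Type*} [MeasurableSpace E] [MeasurableSpace Ω]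
    (Q : Measure E) (P : Measure Ω) (B : (E → ℝ) → Ω → ℝ) : Prop where
  gaussian : IsGaussianProcess (fun (f : {f : E → ℝ // MemLp f 2 Q}) => B f.1) P
  mean_zero : ∀ f : E → ℝ, MemLp f 2 Q → ∫ ω, B f ω ∂P = 0
  covariance : ∀ f h : E → ℝ, MemLp f 2 Q → MemLp h 2 Q →
    cov[B f, B h; P] = ∫ x, f x * h x ∂Q - (∫ x, f x ∂Q) * ∫ x, h x ∂Q

/-- The bounded Lipschitz distance between two probability measures on the line: the supremum of
`|∫ h dμ - ∫ h dν|` over all functions `h : ℝ → [-1, 1]` with Lipschitz constant at most `1`. -/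
def blDist (μ ν : Measure ℝ) : ℝ :=
  ⨆ h : {h : ℝ → ℝ // (∀ z, |h z| ≤ 1) ∧ LipschitzWith 1 h}, |∫ z, h.1 z ∂μ - ∫ z, h.1 z ∂ν|

/-! ### The missing outcomes model -/

/-- The sample space of one observation: an outcome in `Y`, or the missingness symbol. A set is
measurable iff its part in `Y` is, and the symbol is a measurable isolated point. -/
abbrev Obs (Y : Type*) := Y ⊕ Unit

namespace Obs

variable {Y : Type*}

/-- The missingness symbol `∗`. -/
def star : Obs Y := Sum.inr ()

/-- The indicator function of `{∗}`. -/
def starInd : Obs Y → ℝ := Set.indicator {star} fun _ => 1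

/-- The extension of a function of the outcome by the value `0` at `∗`. -/
def ext (f : Y → ℝ) : Obs Y → ℝ := Sum.elim f fun _ => 0

/-- The function `e^q`, with `e^q = 0` at `∗`. -/
def expFn (q : Y → ℝ) : Obs Y → ℝ := ext fun y => Real.exp (q y)

/-- The function `g e^q`, which vanishes at `∗`. -/
def mulExpFn (g q : Y → ℝ) : Obs Y → ℝ := ext fun y => g y * Real.exp (q y)

variable [MeasurableSpace Y]

/-- The parameter of interest `χ(H, q) = H(g e^q) H{∗} / H(e^q) + H g`. -/
def chi (g q : Y → ℝ) (H : Measure (Obs Y)) : ℝ :=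
  (∫ x, mulExpFn g q x ∂H) * H.real {star} / (∫ x, expFn q x ∂H) + ∫ x, ext g x ∂H

/-- The law of `√n (χ(H, q) - χ(ℍₙ, q))` for `H` distributed according to `D` and `ℍₙ` the
empirical measure of the sample `x`. -/
def centredLaw (g q : Y → ℝ) {n : ℕ} (x : Fin n → Obs Y)
    (D : Measure (ProbabilityMeasure (Obs Y))) : Measure ℝ :=
  D.map fun (H : ProbabilityMeasure (Obs Y)) =>
    √(n : ℝ) * (chi g q (H : Measure (Obs Y)) - chi g q (empiricalMeasure x))

/-- The linear combination of four coordinates of the process `B` that appears as the limit. -/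
def limitVar {Ω : Type*} (g q : Y → ℝ) (H₀ : Measure (Obs Y)) (B : (Obs Y → ℝ) → Ω → ℝ)
    (ω : Ω) : ℝ :=
  B starInd ω * (∫ x, mulExpFn g q x ∂H₀) / (∫ x, expFn q x ∂H₀)
    + H₀.real {star} * B (mulExpFn g q) ω / (∫ x, expFn q x ∂H₀)
    - H₀.real {star} * (∫ x, mulExpFn g q x ∂H₀) * B (expFn q) ω / (∫ x, expFn q x ∂H₀) ^ 2
    + B (ext g) ω

/-- The function of one observation with the same coefficients as `limitVar`. -/
def limitFn (g q : Y → ℝ) (H₀ : Measure (Obs Y)) (x : Obs Y) : ℝ :=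
  starInd x * (∫ z, mulExpFn g q z ∂H₀) / (∫ z, expFn q z ∂H₀)
    + H₀.real {star} * mulExpFn g q x / (∫ z, expFn q z ∂H₀)
    - H₀.real {star} * (∫ z, mulExpFn g q z ∂H₀) * expFn q x / (∫ z, expFn q z ∂H₀) ^ 2
    + ext g x

end Obs

end

/-!
The posterior of a linear functional `H f` is treated first, and `χ` is then reduced to linear
functionals by the delta method.

*Moments.* The only integral facts used about a Dirichlet process with base measure `α`, of total
mass `m`, are its first two moment measures, `E H = α / m` and
`E (H ⊗ H) = (α ⊗ α + diag α) / (m (m + 1))` (`comp_evalKernel`, `comp_evalKernel_prod`). They follow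
from the second moments of Dirichlet vectors, where the random denominator is removed by
`1 / S ^ 2 = ∫ u e^{-uS} du`. Consequently `H f` is finite almost surely and has variance at most
`α (f ^ 2) / (m (m + 1))` (`integral_sq_sub_le`), so the second moment of `√n (H f - ℍₙ f)` is
asymptotically at most `2 H₀ (f ^ 2)` (`errorBound`).

*Linear functionals.* If `f` takes finitely many values, `√n (H f - ℍₙ f)` is the ratio of a
centred linear combination of independent gamma variables, whose characteristic function is explicit
(`charFun_gammaLaw`), and a factor tending to `1`. This gives a normal limit with variance
`Var_{H₀} f`. A square-integrable `f` is approximated in `L²(H₀)` by such functions; by the moment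
bound the approximation error is small uniformly in `n`
(`ae_tendsto_integral_exp_scaledError`). The strong law of large numbers is needed for countably many
functions only, which leaves a single null set of sample sequences.

*Delta method.* `χ (H, q)` is a strictly differentiable function of the four means `H{∗}`,
`H (g e^q)`, `H (e^q)`, `H g`, and its derivative at `H₀` applied to the errors is the error for the
function `limitFn` (`tendsto_integral_exp_delta`, `hasStrictFDerivAt_chiFn`).

Lévy's continuity theorem turns convergence of characteristic functions into weak convergence, and the
Lévy–Prokhorov metric turns weak convergence into convergence in the bounded Lipschitz distance
(`tendsto_blDist`). For the Brownian bridge, a linear combination of coordinates of a centred Gaussian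
process is centred normal, and its variance is read off from the covariances.
-/

/-! ### Gamma distributions -/

lemma isProbabilityMeasure_gammaLaw {s : ℝ} (hs : 0 ≤ s) : IsProbabilityMeasure (gammaLaw s) := by
  rcases hs.eq_or_lt with rfl | h
  · simpa [gammaLaw] using (inferInstance : IsProbabilityMeasure (Measure.dirac (0 : ℝ)))
  · simpa [gammaLaw, h.ne'] using isProbabilityMeasure_gammaMeasure h one_pos

lemma ae_nonneg_gammaLaw {s : ℝ} (hs : 0 ≤ s) : ∀ᵐ y ∂gammaLaw s, 0 ≤ y := by
  rcases hs.eq_or_lt with rfl | h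
  · simp [gammaLaw, ae_dirac_eq]
  · rw [gammaLaw, if_neg h.ne', gammaMeasure, ae_withDensity_iff (by unfold gammaPDF; fun_prop)]
    refine ae_of_all _ fun y hy => ?_
    by_contra hy'
    exact hy (gammaPDF_of_neg (not_le.mp hy'))

lemma Real.Gamma_add_natCast_eq_prod {s : ℝ} (hs : 0 < s) (k : ℕ) :
    Real.Gamma (s + k) = (∏ j ∈ Finset.range k, (s + j)) * Real.Gamma s := by
  induction k with
  | zero => simp
  | succ k ih =>
    rw [Finset.prod_range_succ, Nat.cast_succ, ← add_assoc, Real.Gamma_add_one (by positivity), ih]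
    ring

/-- The exponential moments `E (Y ^ k e ^ (tY))` of a gamma variable. For shape `0` and `k > 0` both
sides vanish, the factor `j = 0` of the product being `0`. -/
lemma integral_gammaLaw_pow_mul_exp {s : ℝ} (hs : 0 ≤ s) (k : ℕ) {t : ℝ} (ht : t < 1) :
    ∫ y, y ^ k * Real.exp (t * y) ∂gammaLaw s
      = (∏ j ∈ Finset.range k, (s + j)) * (1 - t) ^ (-(s + k)) := by
  rcases hs.eq_or_lt with rfl | h
  · cases k with
    | zero => simp [gammaLaw]
    | succ k => simp [gammaLaw, Finset.prod_range_succ']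
  · rw [gammaLaw, if_neg h.ne', gammaMeasure,
      integral_withDensity_eq_integral_toReal_smul (by unfold gammaPDF; fun_prop)
        (ae_of_all _ fun _ => by simp [gammaPDF])]
    have h1 : ∀ y, (gammaPDF s 1 y).toReal • (y ^ k * Real.exp (t * y))
        = (Set.Ici 0).indicator (fun y => (Real.Gamma s)⁻¹ *
            (y ^ (s - 1) * y ^ k * Real.exp (-((1 - t) * y)))) y := by
      intro y
      rw [gammaPDF, ENNReal.toReal_ofReal (gammaPDFReal_nonneg h one_pos y), gammaPDFReal]
      by_cases hy : 0 ≤ y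
      · rw [Set.indicator_of_mem (by simpa using hy), if_pos hy, Real.one_rpow,
          show -((1 - t) * y) = -(1 * y) + t * y by ring, Real.exp_add, smul_eq_mul]
        ring
      · rw [Set.indicator_of_notMem (by simpa using hy), if_neg hy, zero_smul]
    rw [integral_congr_ae (ae_of_all _ h1), integral_indicator measurableSet_Ici, integral_const_mul, integral_Ici_eq_integral_Ioi]
    have h2 : ∫ y in Set.Ioi (0 : ℝ), y ^ (s - 1) * y ^ k * Real.exp (-((1 - t) * y))
        = ∫ y in Set.Ioi (0 : ℝ), y ^ ((s + k) - 1) * Real.exp (-((1 - t) * y)) := by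
      refine setIntegral_congr_fun measurableSet_Ioi fun y (hy : 0 < y) => ?_
      rw [← Real.rpow_natCast, ← Real.rpow_add hy]
      ring_nf
    rw [h2, Real.integral_rpow_mul_exp_neg_mul_Ioi (by positivity) (by linarith), one_div,
      Real.inv_rpow (by linarith), ← Real.rpow_neg (by linarith)]
    rw [Real.Gamma_add_natCast_eq_prod h k]
    field_simp [(Real.Gamma_pos_of_pos h).ne']

lemma integrable_gammaLaw_pow_mul_exp {s : ℝ} (hs : 0 ≤ s) (k : ℕ) {t : ℝ} (ht : t < 1) :
    Integrable (fun y => y ^ k * Real.exp (t * y)) (gammaLaw s) := by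
  rcases hs.eq_or_lt with rfl | h
  · simp only [gammaLaw, if_true]
    exact integrable_dirac (by simp)
  · refine Integrable.of_integral_ne_zero ?_
    rw [integral_gammaLaw_pow_mul_exp hs k ht]
    have : 0 < 1 - t := by linarith
    positivity

/-- The characteristic function of the gamma distribution, by analytic continuation of its moment
generating function from the real interval `t < 1` to the half-plane `re z < 1`. -/
lemma charFun_gammaLaw {s : ℝ} (hs : 0 ≤ s) (θ : ℝ) :
    charFun (gammaLaw s) θ = Complex.exp (-s * Complex.log (1 - θ * Complex.I)) := by
  have := isProbabilityMeasure_gammaLaw hs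
  have hset : Set.Iio 1 ⊆ interior (integrableExpSet id (gammaLaw s)) := by
    refine interior_maximal (fun t ht => ?_) isOpen_Iio
    simpa [integrableExpSet] using integrable_gammaLaw_pow_mul_exp hs 0 ht
  have hU : {z : ℂ | z.re < 1} ⊆ {z | z.re ∈ interior (integrableExpSet id (gammaLaw s))} :=
    fun z hz => hset hz
  have h1 : AnalyticOnNhd ℂ (complexMGF id (gammaLaw s)) {z : ℂ | z.re < 1} :=
    analyticOnNhd_complexMGF.mono hU
  have h2 : AnalyticOnNhd ℂ (fun z : ℂ => Complex.exp (-s * Complex.log (1 - z)))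
      {z : ℂ | z.re < 1} := by
    refine DifferentiableOn.analyticOnNhd (fun z hz => ?_)
      (isOpen_Iio.preimage Complex.continuous_re)
    refine DifferentiableAt.differentiableWithinAt ?_
    refine (DifferentiableAt.const_mul (DifferentiableAt.clog (by fun_prop) ?_) _).cexp
    rw [Complex.mem_slitPlane_iff]
    left
    simpa using hz
  have hfreq : ∃ᶠ z : ℂ in 𝓝[≠] 0, complexMGF id (gammaLaw s) z
      = Complex.exp (-s * Complex.log (1 - z)) := by
    have h3 : Tendsto (fun x : ℝ => (x : ℂ)) (𝓝[≠] 0) (𝓝[≠] 0) := by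
      refine tendsto_nhdsWithin_of_tendsto_nhds_of_eventually_within _ ?_ ?_
      · simpa using (Complex.continuous_ofReal.tendsto 0).mono_left nhdsWithin_le_nhds
      · filter_upwards [self_mem_nhdsWithin] with x hx
        simpa using hx
    refine h3.frequently (Eventually.frequently ?_)
    have : ∀ᶠ x : ℝ in 𝓝[≠] 0, x < 1 := nhdsWithin_le_nhds (Iio_mem_nhds one_pos)
    filter_upwards [this] with x hx
    rw [complexMGF_ofReal, mgf]
    have h4 := integral_gammaLaw_pow_mul_exp hs 0 hx
    simp only [pow_zero, one_mul, Finset.range_zero, Finset.prod_empty, Nat.cast_zero,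
      add_zero] at h4
    simp only [id]
    rw [h4, Real.rpow_def_of_pos (by linarith)]
    push_cast
    rw [Complex.ofReal_log (by linarith)]
    push_cast
    ring_nf
  have h0 : (0 : ℂ) ∈ {z : ℂ | z.re < 1} := by simp
  have := h1.eqOn_of_preconnected_of_frequently_eq h2
    (convex_halfSpace_re_lt 1).isPreconnected h0 hfreq
  have h5 := this (show (θ * Complex.I : ℂ) ∈ {z : ℂ | z.re < 1} by simp)
  rw [complexMGF_id_mul_I] at h5
  exact h5

/-! ### Second moments of Dirichlet vectors -/

section Dirichlet

variable {k : ℕ} {s : Fin k → ℝ}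

lemma isProbabilityMeasure_dirichletLaw (hs : ∀ i, 0 ≤ s i) :
    IsProbabilityMeasure (dirichletLaw s) := by
  have := fun i => isProbabilityMeasure_gammaLaw (hs i)
  exact Measure.isProbabilityMeasure_map (by fun_prop)

lemma ae_nonneg_pi_gammaLaw (hs : ∀ i, 0 ≤ s i) :
    ∀ᵐ y ∂Measure.pi fun i => gammaLaw (s i), ∀ i, 0 ≤ y i := by
  have := fun i => isProbabilityMeasure_gammaLaw (hs i)
  rw [ae_all_iff]
  exact fun i => (measurePreserving_eval (fun i => gammaLaw (s i)) i).quasiMeasurePreserving.ae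
    (ae_nonneg_gammaLaw (hs i))

lemma pi_mul_mul_exp_eq_prod (i j : Fin k) (t : ℝ) (y : Fin k → ℝ) :
    y i * y j * Real.exp (t * ∑ l, y l)
      = ∏ l, (y l ^ ((if l = i then 1 else 0) + (if l = j then 1 else 0)) * Real.exp (t * y l)) := by
  rw [Finset.prod_mul_distrib, Finset.mul_sum, Real.exp_sum]
  congr 1
  simp_rw [pow_add, Finset.prod_mul_distrib, pow_ite, pow_one, pow_zero]
  simp

lemma integrable_pi_gammaLaw_mul_mul_exp (hs : ∀ i, 0 ≤ s i) (i j : Fin k) {t : ℝ} (ht : t < 1) :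
    Integrable (fun y : Fin k → ℝ => y i * y j * Real.exp (t * ∑ l, y l))
      (Measure.pi fun i => gammaLaw (s i)) := by
  have := fun i => isProbabilityMeasure_gammaLaw (hs i)
  simp_rw [pi_mul_mul_exp_eq_prod]
  exact Integrable.fintype_prod fun l => integrable_gammaLaw_pow_mul_exp (hs l) _ ht

lemma integral_pi_gammaLaw_mul_mul_exp (hs : ∀ i, 0 ≤ s i) (i j : Fin k) {t : ℝ} (ht : t < 1) :
    ∫ y, y i * y j * Real.exp (t * ∑ l, y l) ∂(Measure.pi fun i => gammaLaw (s i))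
      = s i * (s j + if i = j then 1 else 0) * (1 - t) ^ (-(∑ l, s l + 2)) := by
  have := fun i => isProbabilityMeasure_gammaLaw (hs i)
  simp_rw [pi_mul_mul_exp_eq_prod]
  rw [integral_fintype_prod_eq_prod (f := fun l x =>
    x ^ ((if l = i then 1 else 0) + (if l = j then 1 else 0)) * Real.exp (t * x))]
  simp_rw [fun l => integral_gammaLaw_pow_mul_exp (hs l)
    ((if l = i then 1 else 0) + (if l = j then 1 else 0)) ht]
  rw [Finset.prod_mul_distrib, ← Real.rpow_sum_of_pos (by linarith)]
  congr 1
  · by_cases hij : i = j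
    · subst hij
      rw [Finset.prod_eq_single i]
      · simp [Finset.prod_range_succ]
      · intro l _ hl
        simp [hl]
      · simp
    · have : ∀ l, ∏ r ∈ Finset.range ((if l = i then 1 else 0) + (if l = j then 1 else 0)),
          (s l + r) = (if l = i then s l else 1) * (if l = j then s l else 1) := by
        intro l
        by_cases h1 : l = i
        · have h2 : l ≠ j := fun h => hij (h1.symm.trans h)
          simp [h1, hij]
        · by_cases h2 : l = j <;> simp [h1, h2, Ne.symm hij]
      simp_rw [this, Finset.prod_mul_distrib]
      simp [hij]
  · rw [Finset.sum_neg_distrib, Finset.sum_add_distrib]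
    congr 3
    push_cast
    rw [Finset.sum_add_distrib]
    simp
    norm_num

lemma ofReal_inv_sq_eq_lintegral {S : ℝ} (hS : 0 < S) :
    ENNReal.ofReal ((S ^ 2)⁻¹) = ∫⁻ u in Set.Ioi (0 : ℝ), ENNReal.ofReal (u * Real.exp (-u * S)) := by
  have h := Real.integral_rpow_mul_exp_neg_mul_Ioi (a := 2) (by norm_num) hS
  have h1 : ∫ u in Set.Ioi (0 : ℝ), u * Real.exp (-u * S) = (S ^ 2)⁻¹ := by
    rw [Real.Gamma_two] at h
    convert h using 1
    · refine setIntegral_congr_fun measurableSet_Ioi fun y (hy : 0 < y) => ?_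
      rw [show (2 : ℝ) - 1 = 1 by norm_num, Real.rpow_one]
      ring_nf
    · norm_num
  rw [← h1, ofReal_integral_eq_lintegral_ofReal]
  · refine Integrable.of_integral_ne_zero ?_
    rw [h1]
    positivity
  · filter_upwards [ae_restrict_mem measurableSet_Ioi] with u (hu : 0 < u)
    positivity

/-- The second moments of a Dirichlet vector, up to a normalizing constant. The factor `1 / S ^ 2`
is written as `∫ u e^{-uS} du`, which decouples the independent gamma variables. -/
lemma exists_integral_dirichletLaw_mul (hs : ∀ i, 0 ≤ s i) :
    ∃ K : ℝ, ∀ i j, ∫ p, p i * p j ∂dirichletLaw s = s i * (s j + if i = j then 1 else 0) * K := by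
  have := fun i => isProbabilityMeasure_gammaLaw (hs i)
  refine ⟨(∫⁻ u in Set.Ioi (0 : ℝ),
    ENNReal.ofReal u * ENNReal.ofReal ((1 + u) ^ (-(∑ l, s l + 2)))).toReal, fun i j => ?_⟩
  rw [dirichletLaw, integral_map (by fun_prop) (by fun_prop), integral_eq_lintegral_of_nonneg_ae]
  · have h1 : ∀ᵐ y ∂Measure.pi fun i => gammaLaw (s i),
        ENNReal.ofReal ((y i / ∑ l, y l) * (y j / ∑ l, y l)) = ∫⁻ u in Set.Ioi (0 : ℝ),
          ENNReal.ofReal u * ENNReal.ofReal (y i * y j * Real.exp (-u * ∑ l, y l)) := by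
      filter_upwards [ae_nonneg_pi_gammaLaw hs] with y hy
      rcases (Finset.sum_nonneg fun l _ => hy l).eq_or_lt with h | h
      · have : y i = 0 :=
          (Finset.sum_eq_zero_iff_of_nonneg fun l _ => hy l).1 h.symm i (Finset.mem_univ i)
        simp [this]
      · have h2 : (y i / ∑ l, y l) * (y j / ∑ l, y l) = y i * y j * ((∑ l, y l) ^ 2)⁻¹ := by
          field_simp
        rw [h2, ENNReal.ofReal_mul (mul_nonneg (hy i) (hy j)), ofReal_inv_sq_eq_lintegral h,
          ← lintegral_const_mul _ (by fun_prop)]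
        refine setLIntegral_congr_fun measurableSet_Ioi fun u (hu : 0 < u) => ?_
        rw [← ENNReal.ofReal_mul (mul_nonneg (hy i) (hy j)), ← ENNReal.ofReal_mul hu.le]
        ring_nf
    rw [lintegral_congr_ae h1, lintegral_lintegral_swap (by fun_prop)]
    have h3 : ∀ u ∈ Set.Ioi (0 : ℝ),
        ∫⁻ y, ENNReal.ofReal u * ENNReal.ofReal (y i * y j * Real.exp (-u * ∑ l, y l))
          ∂(Measure.pi fun i => gammaLaw (s i))
        = ENNReal.ofReal (s i * (s j + if i = j then 1 else 0)) *
          (ENNReal.ofReal u * ENNReal.ofReal ((1 + u) ^ (-(∑ l, s l + 2)))) := by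
      intro u (hu : 0 < u)
      have hu1 : -u < 1 := by linarith
      have hnn : 0 ≤ s i * (s j + if i = j then 1 else 0) :=
        mul_nonneg (hs i) (add_nonneg (hs j) (by split_ifs <;> norm_num))
      rw [lintegral_const_mul _ (by fun_prop), ← ofReal_integral_eq_lintegral_ofReal
        (integrable_pi_gammaLaw_mul_mul_exp hs i j hu1) ?_,
        integral_pi_gammaLaw_mul_mul_exp hs i j hu1, ENNReal.ofReal_mul hnn, sub_neg_eq_add]
      · ring
      · filter_upwards [ae_nonneg_pi_gammaLaw hs] with y hy
        exact mul_nonneg (mul_nonneg (hy i) (hy j)) (Real.exp_pos _).le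
    rw [setLIntegral_congr_fun measurableSet_Ioi h3, lintegral_const_mul _ (by fun_prop),
      ENNReal.toReal_mul, ENNReal.toReal_ofReal
        (mul_nonneg (hs i) (add_nonneg (hs j) (by split_ifs <;> norm_num)))]
  · filter_upwards [ae_nonneg_pi_gammaLaw hs] with y hy
    have := Finset.sum_nonneg fun l (_ : l ∈ Finset.univ) => hy l
    exact mul_nonneg (div_nonneg (hy i) this) (div_nonneg (hy j) this)
  · exact Measurable.aestronglyMeasurable (by fun_prop)

end Dirichlet

/-! ### Moment measures of a Dirichlet process -/

section DirichletProcess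

variable {E : Type*} [MeasurableSpace E]

/-- The tautological Markov kernel from probability measures on `E` to `E`, which sends `H` to `H`
itself. -/
def evalKernel (E : Type*) [MeasurableSpace E] : Kernel (ProbabilityMeasure E) E where
  toFun H := H
  measurable' := measurable_subtype_coe

lemma evalKernel_apply (H : ProbabilityMeasure E) : evalKernel E H = (H : Measure E) := rfl

instance : IsMarkovKernel (evalKernel E) := ⟨fun H => H.2⟩

lemma measureReal_univ_pos_of_ne_zero {μ : Measure E} [IsFiniteMeasure μ] (hμ : μ ≠ 0) :
    0 < μ.real Set.univ := by
  simpa [measureReal_def, ENNReal.toReal_pos_iff, measure_lt_top, pos_iff_ne_zero] using hμ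

lemma measurable_measureReal_coe {A : Set E} (hA : MeasurableSet A) :
    Measurable fun H : ProbabilityMeasure E => (H : Measure E).real A :=
  ((Measure.measurable_coe hA).comp measurable_subtype_coe).ennreal_toReal

lemma measurable_integral_coe {f : E → ℝ} (hf : Measurable f) :
    Measurable fun H : ProbabilityMeasure E => ∫ x, f x ∂(H : Measure E) :=
  (hf.stronglyMeasurable.integral_kernel (κ := evalKernel E)).measurable

lemma integral_comp_fin {k : ℕ} {π : E → Fin k} (hπ : Measurable π) (c : Fin k → ℝ)
    (μ : Measure E) [IsFiniteMeasure μ] :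
    ∫ x, c (π x) ∂μ = ∑ i, c i * μ.real (π ⁻¹' {i}) := by
  rw [← integral_map (f := c) hπ.aemeasurable (by fun_prop), integral_fintype (.of_finite)]
  refine Finset.sum_congr rfl fun i _ => ?_
  rw [map_measureReal_apply hπ (measurableSet_singleton i), smul_eq_mul, mul_comm]

lemma measureReal_univ_eq_sum_fiber {k : ℕ} {π : E → Fin k} (hπ : Measurable π)
    (μ : Measure E) [IsFiniteMeasure μ] : μ.real Set.univ = ∑ i, μ.real (π ⁻¹' {i}) := by
  simpa using integral_comp_fin hπ (fun _ => 1) μ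

lemma integral_comp_measure {F : Type*} [MeasurableSpace F] {κ : Kernel F E} {μ : Measure F}
    {f : E → ℝ} (hf : Integrable f (κ ∘ₘ μ)) :
    ∫ x, f x ∂(κ ∘ₘ μ) = ∫ y, ∫ x, f x ∂κ y ∂μ := by
  rw [Measure.comp_eq_comp_const_apply] at hf ⊢
  simpa using ProbabilityTheory.Kernel.integral_comp hf

variable {α : Measure E} {D : Measure (ProbabilityMeasure E)}

namespace IsDirichletProcess

lemma isProbabilityMeasure (h : IsDirichletProcess α D) : IsProbabilityMeasure D := by
  have h1 := h 1 (fun _ => Set.univ) (fun _ => MeasurableSet.univ)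
    (fun i j hij => absurd (Subsingleton.elim i j) hij) (Set.iUnion_const _)
  have h2 := isProbabilityMeasure_dirichletLaw (s := fun _ : Fin 1 => α.real Set.univ)
    (fun _ => measureReal_nonneg)
  rw [← h1] at h2
  exact Measure.isProbabilityMeasure_of_map
    fun (H : ProbabilityMeasure E) (_ : Fin 1) => (H : Measure E).real Set.univ

lemma map_fiber (h : IsDirichletProcess α D) {k : ℕ} {π : E → Fin k} (hπ : Measurable π) :
    D.map (fun (H : ProbabilityMeasure E) i => (H : Measure E).real (π ⁻¹' {i}))
      = dirichletLaw fun i => α.real (π ⁻¹' {i}) := by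
  refine h k (fun i => π ⁻¹' {i}) (fun i => hπ (measurableSet_singleton i)) ?_ ?_
  · intro i j hij
    exact Disjoint.preimage π (by simpa using hij)
  · ext x
    simp

variable [IsFiniteMeasure α]

/-- The second moments of the masses of the fibres of a finite-valued map. -/
lemma integral_fiber_mul (h : IsDirichletProcess α D) (hα : α ≠ 0) {k : ℕ} {π : E → Fin k}
    (hπ : Measurable π) (i j : Fin k) :
    ∫ H : ProbabilityMeasure E, (H : Measure E).real (π ⁻¹' {i}) * (H : Measure E).real (π ⁻¹' {j}) ∂D
      = α.real (π ⁻¹' {i}) * (α.real (π ⁻¹' {j}) + if i = j then 1 else 0)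
        / (α.real Set.univ * (α.real Set.univ + 1)) := by
  have := h.isProbabilityMeasure
  have hmeas : ∀ i, Measurable fun H : ProbabilityMeasure E => (H : Measure E).real (π ⁻¹' {i}) :=
    fun i => measurable_measureReal_coe (hπ (measurableSet_singleton i))
  have hm := measureReal_univ_pos_of_ne_zero hα
  obtain ⟨K, hK⟩ := exists_integral_dirichletLaw_mul
    (s := fun i => α.real (π ⁻¹' {i})) (fun i => measureReal_nonneg)
  have hK' : ∀ i j, ∫ H : ProbabilityMeasure E,
      (H : Measure E).real (π ⁻¹' {i}) * (H : Measure E).real (π ⁻¹' {j}) ∂D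
        = α.real (π ⁻¹' {i}) * (α.real (π ⁻¹' {j}) + if i = j then 1 else 0) * K := by
    intro i j
    rw [← hK i j, ← h.map_fiber hπ,
      integral_map (measurable_pi_lambda _ hmeas).aemeasurable (by fun_prop)]
  -- The constant is determined by the total mass of `H`, which is `1`.
  have hone : 1 = (α.real Set.univ * (α.real Set.univ + 1)) * K := by
    calc (1 : ℝ) = ∫ H : ProbabilityMeasure E, ∑ i, ∑ j,
          (H : Measure E).real (π ⁻¹' {i}) * (H : Measure E).real (π ⁻¹' {j}) ∂D := by
            have : ∀ H : ProbabilityMeasure E, ∑ i, ∑ j,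
                (H : Measure E).real (π ⁻¹' {i}) * (H : Measure E).real (π ⁻¹' {j}) = 1 := by
              intro H
              rw [← Finset.sum_mul_sum, ← measureReal_univ_eq_sum_fiber hπ]
              simp
            simp_rw [this]
            simp
      _ = ∑ i, ∑ j, α.real (π ⁻¹' {i}) * (α.real (π ⁻¹' {j}) + if i = j then 1 else 0) * K := by
            have hint : ∀ i j, Integrable (fun H : ProbabilityMeasure E =>
                (H : Measure E).real (π ⁻¹' {i}) * (H : Measure E).real (π ⁻¹' {j})) D := by
              intro i j
              refine Integrable.of_bound ((hmeas i).mul (hmeas j)).aestronglyMeasurable 1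
                (ae_of_all _ fun H => ?_)
              rw [Real.norm_of_nonneg (by positivity)]
              exact mul_le_one₀ measureReal_le_one measureReal_nonneg measureReal_le_one
            rw [integral_finsetSum _ fun i _ => integrable_finsetSum _ fun j _ => hint i j]
            refine Finset.sum_congr rfl fun i _ => ?_
            rw [integral_finsetSum _ fun j _ => hint i j]
            exact Finset.sum_congr rfl fun j _ => hK' i j
      _ = _ := by
            simp_rw [mul_add, add_mul, Finset.sum_add_distrib, mul_ite, ite_mul, mul_one, mul_zero,
              zero_mul, Finset.sum_ite_eq, Finset.mem_univ, if_true]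
            simp_rw [← Finset.sum_mul]
            rw [← Finset.sum_mul_sum, ← measureReal_univ_eq_sum_fiber hπ]
  rw [hK' i j, eq_div_iff (by positivity)]
  linear_combination (-(α.real (π ⁻¹' {i}) * (α.real (π ⁻¹' {j}) + if i = j then 1 else 0))) * hone

lemma integral_comp_fin_mul (h : IsDirichletProcess α D) (hα : α ≠ 0) {k : ℕ} {π : E → Fin k}
    (hπ : Measurable π) (c d : Fin k → ℝ) :
    ∫ H : ProbabilityMeasure E, (∫ x, c (π x) ∂(H : Measure E)) * ∫ x, d (π x) ∂(H : Measure E) ∂D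
      = ((∫ x, c (π x) ∂α) * (∫ x, d (π x) ∂α) + ∫ x, c (π x) * d (π x) ∂α)
        / (α.real Set.univ * (α.real Set.univ + 1)) := by
  have := h.isProbabilityMeasure
  have hmeas : ∀ i, Measurable fun H : ProbabilityMeasure E => (H : Measure E).real (π ⁻¹' {i}) :=
    fun i => measurable_measureReal_coe (hπ (measurableSet_singleton i))
  simp_rw [integral_comp_fin hπ, integral_comp_fin hπ (fun i => c i * d i), Finset.sum_mul_sum]
  have hint : ∀ i j, Integrable (fun H : ProbabilityMeasure E =>
      c i * (H : Measure E).real (π ⁻¹' {i}) * (d j * (H : Measure E).real (π ⁻¹' {j}))) D := by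
    intro i j
    refine Integrable.of_bound (by fun_prop) (|c i| * |d j|)
      (ae_of_all _ fun H => ?_)
    rw [Real.norm_eq_abs, abs_mul, abs_mul, abs_mul, abs_of_nonneg measureReal_nonneg,
      abs_of_nonneg measureReal_nonneg]
    gcongr
    · exact mul_le_of_le_one_right (abs_nonneg _) measureReal_le_one
    · exact mul_le_of_le_one_right (abs_nonneg _) measureReal_le_one
  rw [integral_finsetSum _ fun i _ => integrable_finsetSum _ fun j _ => hint i j,
    ← Finset.sum_add_distrib, Finset.sum_div]
  refine Finset.sum_congr rfl fun i _ => ?_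
  rw [integral_finsetSum _ fun j _ => hint i j]
  have h1 : ∀ j, ∫ H : ProbabilityMeasure E,
      c i * (H : Measure E).real (π ⁻¹' {i}) * (d j * (H : Measure E).real (π ⁻¹' {j})) ∂D
      = c i * d j * (α.real (π ⁻¹' {i}) * (α.real (π ⁻¹' {j}) + if i = j then 1 else 0)
        / (α.real Set.univ * (α.real Set.univ + 1))) := by
    intro j
    rw [← h.integral_fiber_mul hα hπ, ← integral_const_mul]
    refine integral_congr_ae (ae_of_all _ fun H => ?_)
    ring
  simp_rw [h1]
  rw [← Finset.sum_add_sum_compl {i}, ← Finset.sum_add_sum_compl {i}, Finset.sum_singleton,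
    Finset.sum_singleton, add_right_comm, add_div, Finset.sum_div]
  congr 1
  · simp only [if_true]
    ring
  · refine Finset.sum_congr rfl fun j hj => ?_
    rw [if_neg (by simpa [eq_comm] using hj)]
    ring

/-- The second moments of a Dirichlet process on events, from the partition into the four cells
generated by `s` and `t`. -/
lemma integral_measureReal_mul (h : IsDirichletProcess α D) (hα : α ≠ 0) {s t : Set E}
    (hs : MeasurableSet s) (ht : MeasurableSet t) :
    ∫ H : ProbabilityMeasure E, (H : Measure E).real s * (H : Measure E).real t ∂D
      = (α.real s * α.real t + α.real (s ∩ t)) / (α.real Set.univ * (α.real Set.univ + 1)) := by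
  classical
  let e := Fintype.equivFin (Bool × Bool)
  let π : E → Fin (Fintype.card (Bool × Bool)) := fun x => e (decide (x ∈ s), decide (x ∈ t))
  have hπ : Measurable π := by
    refine (measurable_of_countable e).comp (Measurable.prodMk ?_ ?_)
    · exact measurable_to_bool (by convert hs; ext; simp)
    · exact measurable_to_bool (by convert ht; ext; simp)
  have h1 := h.integral_comp_fin_mul hα hπ (fun i => if (e.symm i).1 then 1 else 0)
    (fun i => if (e.symm i).2 then 1 else 0)
  have hS : (fun x => if (e.symm (π x)).1 then (1 : ℝ) else 0) = s.indicator 1 := by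
    ext x; simp [π, Set.indicator_apply]
  have hT : (fun x => if (e.symm (π x)).2 then (1 : ℝ) else 0) = t.indicator 1 := by
    ext x; simp [π, Set.indicator_apply]
  have hST : (fun x => (if (e.symm (π x)).1 then (1 : ℝ) else 0) *
      if (e.symm (π x)).2 then (1 : ℝ) else 0) = (s ∩ t).indicator 1 := by
    ext x; by_cases h1 : x ∈ s <;> by_cases h2 : x ∈ t <;> simp [π, h1, h2]
  simpa only [hS, hT, hST, integral_indicator_one hs, integral_indicator_one ht,
    integral_indicator_one (hs.inter ht)] using h1

/-- The mean of a Dirichlet process is its normalized base measure. -/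
lemma comp_evalKernel (h : IsDirichletProcess α D) (hα : α ≠ 0) :
    evalKernel E ∘ₘ D = ENNReal.ofReal (α.real Set.univ)⁻¹ • α := by
  have := h.isProbabilityMeasure
  have hm := measureReal_univ_pos_of_ne_zero hα
  ext s hs
  rw [Measure.bind_apply hs (Kernel.aemeasurable _)]
  have h1 := h.integral_measureReal_mul hα hs MeasurableSet.univ
  simp only [probReal_univ, mul_one, Set.inter_univ] at h1
  have h2 : ∀ H : ProbabilityMeasure E, evalKernel E H s
      = ENNReal.ofReal ((H : Measure E).real s) := fun H => by
    rw [evalKernel_apply, ofReal_measureReal]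
  simp_rw [h2]
  rw [← ofReal_integral_eq_lintegral_ofReal
      (Integrable.of_bound (measurable_measureReal_coe hs).aestronglyMeasurable 1
        (ae_of_all _ fun H => by
          rw [Real.norm_of_nonneg measureReal_nonneg]; exact measureReal_le_one))
      (ae_of_all _ fun _ => measureReal_nonneg), h1, Measure.smul_apply, smul_eq_mul,
      ← ofReal_measureReal, ← ENNReal.ofReal_mul (by positivity)]
  congr 1
  field_simp

/-- The second moment measure of a Dirichlet process. -/
lemma comp_evalKernel_prod (h : IsDirichletProcess α D) (hα : α ≠ 0) :
    (evalKernel E ×ₖ evalKernel E) ∘ₘ D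
      = ENNReal.ofReal (α.real Set.univ * (α.real Set.univ + 1))⁻¹ •
        (α.prod α + α.map fun x => (x, x)) := by
  have := h.isProbabilityMeasure
  have hm := measureReal_univ_pos_of_ne_zero hα
  refine Measure.ext_prod fun {s t} hs ht => ?_
  rw [Measure.bind_apply (hs.prod ht) (Kernel.aemeasurable _)]
  have h1 := h.integral_measureReal_mul hα hs ht
  have h2 : ∀ H : ProbabilityMeasure E, (evalKernel E ×ₖ evalKernel E) H (s ×ˢ t)
      = ENNReal.ofReal ((H : Measure E).real s * (H : Measure E).real t) := fun H => by
    rw [Kernel.prod_apply_prod, evalKernel_apply, ENNReal.ofReal_mul measureReal_nonneg,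
      ofReal_measureReal, ofReal_measureReal]
  simp_rw [h2]
  have h3 : Integrable (fun H : ProbabilityMeasure E =>
      (H : Measure E).real s * (H : Measure E).real t) D :=
    Integrable.of_bound ((measurable_measureReal_coe hs).mul
      (measurable_measureReal_coe ht)).aestronglyMeasurable 1 (ae_of_all _ fun H => by
        rw [Real.norm_of_nonneg (by positivity)]
        exact mul_le_one₀ measureReal_le_one measureReal_nonneg measureReal_le_one)
  rw [← ofReal_integral_eq_lintegral_ofReal h3 (ae_of_all _ fun _ => by positivity), h1, Measure.smul_apply, smul_eq_mul,
      Measure.add_apply, Measure.prod_prod, Measure.map_apply (by fun_prop) (hs.prod ht),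
      show (fun x : E => (x, x)) ⁻¹' (s ×ˢ t) = s ∩ t from rfl,
      ← ofReal_measureReal (s := s), ← ofReal_measureReal (s := t),
      ← ofReal_measureReal (s := s ∩ t), ← ENNReal.ofReal_mul (by positivity),
      ← ENNReal.ofReal_add (by positivity) (by positivity), ← ENNReal.ofReal_mul (by positivity)]
  congr 1
  ring

variable {f : E → ℝ}

lemma ae_integrable (h : IsDirichletProcess α D) (hα : α ≠ 0) (hf : Integrable f α) :
    ∀ᵐ H : ProbabilityMeasure E ∂D, Integrable f (H : Measure E) := by
  have h1 : Integrable f (evalKernel E ∘ₘ D) := by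
    rw [h.comp_evalKernel hα]
    exact hf.smul_measure ENNReal.ofReal_ne_top
  exact ((Measure.integrable_comp_iff h1.1).1 h1).1

lemma integral_integral (h : IsDirichletProcess α D) (hα : α ≠ 0) (hf : Integrable f α) :
    ∫ H : ProbabilityMeasure E, ∫ x, f x ∂(H : Measure E) ∂D = (∫ x, f x ∂α) / α.real Set.univ := by
  have h1 : Integrable f (evalKernel E ∘ₘ D) := by
    rw [h.comp_evalKernel hα]
    exact hf.smul_measure ENNReal.ofReal_ne_top
  have h2 := integral_comp_measure h1
  rw [h.comp_evalKernel hα, integral_smul_measure, ENNReal.toReal_ofReal (by positivity)] at h2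
  rw [smul_eq_mul, ← div_eq_inv_mul] at h2
  exact h2.symm

lemma integrable_mul_comp (h : IsDirichletProcess α D) (hα : α ≠ 0) (hf : MemLp f 2 α) :
    Integrable (fun p : E × E => f p.1 * f p.2) ((evalKernel E ×ₖ evalKernel E) ∘ₘ D) := by
  have hf1 : Integrable f α := hf.integrable (by norm_num)
  rw [h.comp_evalKernel_prod hα]
  refine Integrable.smul_measure (Integrable.add_measure (hf1.mul_prod hf1) ?_)
    ENNReal.ofReal_ne_top
  have hd : AEStronglyMeasurable (fun p : E × E => f p.1 * f p.2) (α.map fun x => (x, x)) := by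
    have hq1 : Measure.QuasiMeasurePreserving Prod.fst (α.map fun x => (x, x)) α :=
      ⟨measurable_fst, by
        rw [Measure.map_map measurable_fst (by fun_prop)]
        simp [Function.comp_def, Measure.AbsolutelyContinuous.rfl]⟩
    have hq2 : Measure.QuasiMeasurePreserving Prod.snd (α.map fun x => (x, x)) α :=
      ⟨measurable_snd, by
        rw [Measure.map_map measurable_snd (by fun_prop)]
        simp [Function.comp_def, Measure.AbsolutelyContinuous.rfl]⟩
    exact (hf.1.comp_quasiMeasurePreserving hq1).mul (hf.1.comp_quasiMeasurePreserving hq2)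
  rw [integrable_map_measure hd (by fun_prop)]
  simpa [Function.comp_def, sq] using hf.integrable_sq

lemma integrable_integral_sq (h : IsDirichletProcess α D) (hα : α ≠ 0) (hf : MemLp f 2 α) :
    Integrable (fun H : ProbabilityMeasure E => (∫ x, f x ∂(H : Measure E)) ^ 2) D := by
  have h1 := (h.integrable_mul_comp hα hf)
  have := Integrable.integral_comp (κ := Kernel.const Unit D) (a := ())
    (η := evalKernel E ×ₖ evalKernel E) (f := fun p : E × E => f p.1 * f p.2)
    (by rwa [← Measure.comp_eq_comp_const_apply])
  simpa [Kernel.prod_apply, integral_prod_mul, sq, evalKernel_apply] using this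

lemma integral_integral_sq (h : IsDirichletProcess α D) (hα : α ≠ 0) (hf : MemLp f 2 α) :
    ∫ H : ProbabilityMeasure E, (∫ x, f x ∂(H : Measure E)) ^ 2 ∂D
      = ((∫ x, f x ∂α) ^ 2 + ∫ x, f x ^ 2 ∂α) / (α.real Set.univ * (α.real Set.univ + 1)) := by
  have hf1 : Integrable f α := hf.integrable (by norm_num)
  have h1 := h.integrable_mul_comp hα hf
  have h2 := integral_comp_measure h1
  simp only [Kernel.prod_apply, evalKernel_apply, integral_prod_mul, ← sq] at h2
  rw [← h2]
  rw [h.comp_evalKernel_prod hα] at h1 ⊢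
  have hc : ENNReal.ofReal (α.real Set.univ * (α.real Set.univ + 1))⁻¹ ≠ 0 := by
    have hm := measureReal_univ_pos_of_ne_zero hα
    simp
    positivity
  rw [integrable_smul_measure hc ENNReal.ofReal_ne_top, integrable_add_measure] at h1
  rw [integral_smul_measure, integral_add_measure h1.1 h1.2, integral_prod_mul,
    integral_map (by fun_prop) h1.2.1, ENNReal.toReal_ofReal (by positivity), smul_eq_mul,
    ← div_eq_inv_mul]
  simp [sq]

/-- The variance of a linear functional of a Dirichlet process is at most the second moment of the
normalized base measure divided by its total mass plus one. -/
lemma integral_sq_sub_le (h : IsDirichletProcess α D) (hα : α ≠ 0) (hf : MemLp f 2 α) :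
    ∫ H : ProbabilityMeasure E,
        (∫ x, f x ∂(H : Measure E) - (∫ x, f x ∂α) / α.real Set.univ) ^ 2 ∂D
      ≤ (∫ x, f x ^ 2 ∂α) / (α.real Set.univ * (α.real Set.univ + 1)) := by
  have := h.isProbabilityMeasure
  have hm := measureReal_univ_pos_of_ne_zero hα
  have hf1 : Integrable f α := hf.integrable (by norm_num)
  have h2 : MemLp (fun H : ProbabilityMeasure E => ∫ x, f x ∂(H : Measure E)) 2 D := by
    refine (memLp_two_iff_integrable_sq ?_).2 (h.integrable_integral_sq hα hf)
    have h1 : Integrable f (evalKernel E ∘ₘ D) := by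
      rw [h.comp_evalKernel hα]
      exact hf1.smul_measure ENNReal.ofReal_ne_top
    have := AEStronglyMeasurable.integral_kernel_comp (κ := Kernel.const Unit D) (a := ())
      (η := evalKernel E) (f := f) (by rw [← Measure.comp_eq_comp_const_apply]; exact h1.1)
    simpa [evalKernel_apply] using this
  have hv := variance_eq_sub h2
  rw [variance_eq_integral h2.1.aemeasurable] at hv
  simp only [Pi.pow_apply] at hv
  rw [h.integral_integral hα hf1, h.integral_integral_sq hα hf] at hv
  rw [hv]
  set A := ∫ x, f x ∂α
  set B := ∫ x, f x ^ 2 ∂α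
  set m := α.real Set.univ
  have : (A ^ 2 + B) / (m * (m + 1)) - (A / m) ^ 2
      = B / (m * (m + 1)) - A ^ 2 / (m ^ 2 * (m + 1)) := by
    field_simp
    ring
  rw [this]
  have : 0 ≤ A ^ 2 / (m ^ 2 * (m + 1)) := by positivity
  linarith

end IsDirichletProcess

end DirichletProcess

/-! ### Characteristic functions and sums of gamma variables -/

section CharFun

variable {Ω : Type*} [MeasurableSpace Ω] {μ : Measure Ω}

lemma integral_abs_mul_le_sqrt {f g : Ω → ℝ} (hf : MemLp f 2 μ) (hg : MemLp g 2 μ) :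
    ∫ ω, |f ω * g ω| ∂μ ≤ √(∫ ω, f ω ^ 2 ∂μ) * √(∫ ω, g ω ^ 2 ∂μ) := by
  have h := integral_mul_norm_le_Lp_mul_Lq (μ := μ) (f := f) (g := g) Real.HolderConjugate.two_two
    (by simpa using hf) (by simpa using hg)
  simpa [abs_mul, Real.sqrt_eq_rpow] using h

lemma integral_abs_le_sqrt [IsProbabilityMeasure μ] {f : Ω → ℝ} (hf : MemLp f 2 μ) :
    ∫ ω, |f ω| ∂μ ≤ √(∫ ω, f ω ^ 2 ∂μ) := by
  simpa using integral_abs_mul_le_sqrt hf (memLp_const (μ := μ) (p := 2) (1 : ℝ))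

lemma norm_exp_mul_I_sub_le (x y : ℝ) :
    ‖Complex.exp (x * Complex.I) - Complex.exp (y * Complex.I)‖ ≤ |x - y| := by
  have h : Complex.exp (x * Complex.I) - Complex.exp (y * Complex.I)
      = Complex.exp (y * Complex.I) * (Complex.exp (Complex.I * ((x - y : ℝ) : ℂ)) - 1) := by
    rw [mul_sub, ← Complex.exp_add, mul_one]
    congr 2
    push_cast
    ring
  rw [h, norm_mul, Complex.norm_exp_ofReal_mul_I, one_mul]
  exact Real.norm_exp_I_mul_ofReal_sub_one_le

lemma integrable_exp_mul_I [IsFiniteMeasure μ] {X : Ω → ℝ} (hX : AEMeasurable X μ) :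
    Integrable (fun ω => Complex.exp (X ω * Complex.I)) μ :=
  Integrable.of_bound (by fun_prop) 1 (ae_of_all _ fun ω => by
    rw [Complex.norm_exp_ofReal_mul_I])

lemma norm_integral_exp_sub_le [IsFiniteMeasure μ] {X Y : Ω → ℝ} (hX : AEMeasurable X μ)
    (hY : AEMeasurable Y μ) (t : ℝ) (hXY : Integrable (fun ω => X ω - Y ω) μ) :
    ‖∫ ω, Complex.exp ((t * X ω : ℝ) * Complex.I) ∂μ
        - ∫ ω, Complex.exp ((t * Y ω : ℝ) * Complex.I) ∂μ‖ ≤ |t| * ∫ ω, |X ω - Y ω| ∂μ := by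
  rw [← integral_sub (integrable_exp_mul_I (hX.const_mul t))
    (integrable_exp_mul_I (hY.const_mul t)), ← integral_const_mul]
  refine norm_integral_le_of_norm_le (hXY.abs.const_mul _) (ae_of_all _ fun ω => ?_)
  refine (norm_exp_mul_I_sub_le _ _).trans_eq ?_
  rw [← mul_sub, abs_mul]

end CharFun

/-- A double limit: approximate `u n` by `v k n`, with an error whose limit in `n` vanishes
in `k`. -/
lemma tendsto_of_tendsto_approx {u : ℕ → ℂ} {v : ℕ → ℕ → ℂ} {b : ℕ → ℕ → ℝ} {w : ℕ → ℂ}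
    {β : ℕ → ℝ} {l : ℂ} (hv : ∀ k, Tendsto (v k) atTop (𝓝 (w k)))
    (hb : ∀ k, Tendsto (b k) atTop (𝓝 (β k))) (huv : ∀ k, ∀ᶠ n in atTop, ‖u n - v k n‖ ≤ b k n)
    (hβ : Tendsto β atTop (𝓝 0)) (hw : Tendsto w atTop (𝓝 l)) : Tendsto u atTop (𝓝 l) := by
  rw [Metric.tendsto_nhds]
  intro ε hε
  obtain ⟨k, h1, h2⟩ := ((hβ.eventually (gt_mem_nhds (show 0 < ε / 3 by linarith))).and
    (Metric.tendsto_nhds.1 hw (ε / 3) (by linarith))).exists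
  filter_upwards [(hb k).eventually (gt_mem_nhds h1),
    Metric.tendsto_nhds.1 (hv k) (ε / 3) (by linarith), huv k] with n h3 h4 h5
  rw [← dist_eq_norm] at h5
  linarith [dist_triangle (u n) (v k n) l, dist_triangle (v k n) (w k) l]

section Gamma

lemma memLp_gammaLaw {s : ℝ} (hs : 0 ≤ s) : MemLp (fun y => y) 2 (gammaLaw s) := by
  refine (memLp_two_iff_integrable_sq (by fun_prop)).2 ?_
  simpa using integrable_gammaLaw_pow_mul_exp hs 2 (t := 0) one_pos

lemma integral_id_gammaLaw {s : ℝ} (hs : 0 ≤ s) : ∫ y, y ∂gammaLaw s = s := by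
  simpa using integral_gammaLaw_pow_mul_exp hs 1 (t := 0) one_pos

lemma variance_gammaLaw {s : ℝ} (hs : 0 ≤ s) : Var[fun y => y; gammaLaw s] = s := by
  have := isProbabilityMeasure_gammaLaw hs
  rw [variance_eq_sub (memLp_gammaLaw hs), integral_id_gammaLaw hs]
  have h := integral_gammaLaw_pow_mul_exp hs 2 (t := 0) one_pos
  simp only [zero_mul, Real.exp_zero, mul_one, sub_zero, Real.one_rpow, Finset.prod_range_succ,
    Finset.range_zero, Finset.prod_empty, one_mul, Nat.cast_zero, add_zero, Nat.cast_one] at h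
  simp only [Pi.pow_apply, h]
  ring

variable {k : ℕ} {s : Fin k → ℝ}

lemma memLp_sum_pi_gammaLaw (hs : ∀ i, 0 ≤ s i) :
    MemLp (fun y : Fin k → ℝ => ∑ i, y i) 2 (Measure.pi fun i => gammaLaw (s i)) := by
  have := fun i => isProbabilityMeasure_gammaLaw (hs i)
  exact memLp_finsetSum _ fun i _ => (memLp_gammaLaw (hs i)).comp_measurePreserving
    (measurePreserving_eval (fun i => gammaLaw (s i)) i)

lemma integral_one_sub_sum_div_sq (hs : ∀ i, 0 ≤ s i) {r : ℝ} (hr : r ≠ 0) :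
    ∫ y : Fin k → ℝ, (1 - (∑ i, y i) / r) ^ 2 ∂(Measure.pi fun i => gammaLaw (s i))
      = (∑ i, s i + (∑ i, s i - r) ^ 2) / r ^ 2 := by
  have := fun i => isProbabilityMeasure_gammaLaw (hs i)
  have hS := memLp_sum_pi_gammaLaw hs
  have hmean : ∫ y : Fin k → ℝ, ∑ i, y i ∂(Measure.pi fun i => gammaLaw (s i)) = ∑ i, s i := by
    rw [integral_finsetSum _ fun i _ => integrable_comp_eval (i := i) (f := fun y => y)
      ((memLp_gammaLaw (hs i)).integrable (by norm_num))]
    refine Finset.sum_congr rfl fun i _ => ?_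
    exact (integral_comp_eval (μ := fun i => gammaLaw (s i)) (f := fun y => y) (i := i)
      (by fun_prop)).trans (integral_id_gammaLaw (hs i))
  have hvar : Var[fun y : Fin k → ℝ => ∑ i, y i; Measure.pi fun i => gammaLaw (s i)]
      = ∑ i, s i := by
    have := variance_sum_pi (μ := fun i => gammaLaw (s i)) (X := fun _ y => y)
      fun i => memLp_gammaLaw (hs i)
    simp_rw [fun i => variance_gammaLaw (hs i)] at this
    rw [← this]
    congr 1
    ext y
    simp
  rw [variance_eq_sub hS, hmean] at hvar
  simp only [Pi.pow_apply] at hvar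
  have h1 : ∀ y : Fin k → ℝ, (1 - (∑ i, y i) / r) ^ 2
      = (1 - (2 / r) * ∑ i, y i) + (1 / r ^ 2) * (∑ i, y i) ^ 2 := by
    intro y
    field_simp
    ring
  have hi := hS.integrable (q := 2) (by norm_num)
  have hA : Integrable (fun y : Fin k → ℝ => 1 - (2 / r) * ∑ i, y i)
      (Measure.pi fun i => gammaLaw (s i)) := (integrable_const _).sub (hi.const_mul _)
  simp_rw [h1]
  rw [integral_add hA (hS.integrable_sq.const_mul _),
    integral_sub (integrable_const _) (hi.const_mul _), integral_const_mul, integral_const_mul,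
    hmean, sub_eq_iff_eq_add.1 hvar]
  simp
  field_simp
  ring

lemma integral_exp_sum_pi_gammaLaw (hs : ∀ i, 0 ≤ s i) (d : Fin k → ℝ) (t : ℝ) :
    ∫ y : Fin k → ℝ, Complex.exp ((t * ∑ i, d i * y i : ℝ) * Complex.I)
        ∂(Measure.pi fun i => gammaLaw (s i))
      = Complex.exp (-∑ i, s i * Complex.log (1 - (t * d i : ℝ) * Complex.I)) := by
  have := fun i => isProbabilityMeasure_gammaLaw (hs i)
  have h1 : ∀ y : Fin k → ℝ, Complex.exp ((t * ∑ i, d i * y i : ℝ) * Complex.I)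
      = ∏ i, Complex.exp ((t * d i : ℝ) * y i * Complex.I) := by
    intro y
    rw [← Complex.exp_sum]
    congr 1
    push_cast
    rw [Finset.mul_sum, Finset.sum_mul]
    exact Finset.sum_congr rfl fun i _ => by ring
  simp_rw [h1]
  rw [integral_fintype_prod_eq_prod (f := fun i (x : ℝ) =>
    Complex.exp ((t * d i : ℝ) * x * Complex.I)), ← Finset.sum_neg_distrib, Complex.exp_sum]
  refine Finset.prod_congr rfl fun i _ => ?_
  rw [← charFun_apply_real, charFun_gammaLaw (hs i), neg_mul]

lemma norm_log_one_sub_mul_I_le {x : ℝ} (hx : |x| ≤ 1 / 2) :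
    ‖Complex.log (1 - x * Complex.I) - (-(x * Complex.I) + (x ^ 2 / 2 : ℝ))‖ ≤ |x| ^ 3 := by
  have hn : ‖-(x * Complex.I)‖ = |x| := by simp
  have h := Complex.norm_log_sub_logTaylor_le 2 (z := -(x * Complex.I)) (by rw [hn]; linarith)
  have h2 : Complex.logTaylor (2 + 1) (-(x * Complex.I))
      = -(x * Complex.I) + (x ^ 2 / 2 : ℝ) := by
    simp only [Complex.logTaylor_succ, Complex.logTaylor_zero]
    push_cast
    ring_nf
    simp
    linear_combination (-(x : ℂ) ^ 2 / 2) * Complex.I_sq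
  rw [h2, hn, ← sub_eq_add_neg] at h
  refine h.trans ?_
  have h3 : (1 - |x|)⁻¹ ≤ 2 := by
    rw [inv_le_comm₀ (by linarith) (by norm_num)]
    linarith
  have : 0 ≤ |x| ^ 3 := by positivity
  norm_num
  nlinarith

/-- The central limit theorem for linear combinations `∑ i, d i * Y i` of finitely many independent
gamma variables, in terms of characteristic functions. -/
lemma tendsto_exp_sum_log {s d : ℕ → Fin k → ℝ} (hs : ∀ᶠ n in atTop, ∀ i, 0 ≤ s n i) {v : ℝ}
    (hd : ∀ i, Tendsto (fun n => d n i) atTop (𝓝 0))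
    (h1 : Tendsto (fun n => ∑ i, s n i * d n i) atTop (𝓝 0))
    (h2 : Tendsto (fun n => ∑ i, s n i * d n i ^ 2) atTop (𝓝 v))
    (h3 : Tendsto (fun n => ∑ i, s n i * |d n i| ^ 3) atTop (𝓝 0)) (t : ℝ) :
    Tendsto (fun n => Complex.exp (-∑ i, s n i * Complex.log (1 - (t * d n i : ℝ) * Complex.I)))
      atTop (𝓝 (Complex.exp (-(t ^ 2 * v / 2 : ℝ)))) := by
  refine (Complex.continuous_exp.tendsto _).comp (Tendsto.neg ?_)
  have hmain : Tendsto (fun n => -((t * ∑ i, s n i * d n i : ℝ) * Complex.I)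
      + (t ^ 2 / 2 * ∑ i, s n i * d n i ^ 2 : ℝ)) atTop (𝓝 ((t ^ 2 * v / 2 : ℝ) : ℂ)) := by
    have e1 := ((Complex.continuous_ofReal.tendsto _).comp (h1.const_mul t)).mul_const Complex.I
    have e2 := (Complex.continuous_ofReal.tendsto _).comp (h2.const_mul (t ^ 2 / 2))
    convert e1.neg.add e2 using 2
    · rfl
    · push_cast
      ring
  refine tendsto_of_tendsto_of_dist hmain ?_
  refine squeeze_zero' (Eventually.of_forall fun n => dist_nonneg) ?_
    (by simpa using h3.const_mul (|t| ^ 3))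
  have hsmall : ∀ i, ∀ᶠ n in atTop, |t * d n i| ≤ 1 / 2 := fun i => by
    have := ((hd i).const_mul t).abs
    rw [mul_zero, abs_zero] at this
    exact this.eventually (ge_mem_nhds (by norm_num))
  filter_upwards [eventually_all.2 hsmall, hs] with n hn hsn
  rw [dist_comm, dist_eq_norm]
  have e : ∑ i, s n i * Complex.log (1 - (t * d n i : ℝ) * Complex.I)
      - (-((t * ∑ i, s n i * d n i : ℝ) * Complex.I) + (t ^ 2 / 2 * ∑ i, s n i * d n i ^ 2 : ℝ))
      = ∑ i, s n i * (Complex.log (1 - (t * d n i : ℝ) * Complex.I)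
        - (-((t * d n i : ℝ) * Complex.I) + ((t * d n i) ^ 2 / 2 : ℝ))) := by
    simp_rw [mul_sub, Finset.sum_sub_distrib, mul_add, Finset.sum_add_distrib]
    congr 2
    · push_cast
      rw [Finset.mul_sum, Finset.sum_mul, ← Finset.sum_neg_distrib]
      exact Finset.sum_congr rfl fun i _ => by ring
    · push_cast
      rw [Finset.mul_sum]
      exact Finset.sum_congr rfl fun i _ => by ring
  rw [e, Finset.mul_sum]
  refine norm_sum_le_of_le _ fun i _ => ?_
  rw [norm_mul, Complex.norm_of_nonneg (hsn i)]
  calc _ ≤ s n i * |t * d n i| ^ 3 :=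
        mul_le_mul_of_nonneg_left (norm_log_one_sub_mul_I_le (hn i)) (hsn i)
    _ = _ := by rw [abs_mul]; ring

end Gamma

/-! ### Asymptotic normality for functions with finitely many values -/

section Posterior

variable {E : Type*} [MeasurableSpace E]

/-- The random measures `D n` are Dirichlet processes with base measures `a + n P n`, for
probability measures `P n` (in the application, the empirical measures). -/
structure IsDirichletPosterior (a : Measure E) (P : ℕ → Measure E)
    (D : ℕ → Measure (ProbabilityMeasure E)) : Prop where
  prob : ∀ n : ℕ, 1 ≤ n → IsProbabilityMeasure (P n)
  process : ∀ n : ℕ, 1 ≤ n → IsDirichletProcess (a + (n : ENNReal) • P n) (D n)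

/-- The function `f` is square-integrable and its first two moments under `P n` converge to those
under `H₀`. -/
structure MomentsConverge (a H₀ : Measure E) (P : ℕ → Measure E) (f : E → ℝ) : Prop where
  measurable : Measurable f
  memLp_prior : MemLp f 2 a
  memLp_limit : MemLp f 2 H₀
  memLp : ∀ n : ℕ, 1 ≤ n → MemLp f 2 (P n)
  tendsto_mean : Tendsto (fun n => ∫ x, f x ∂P n) atTop (𝓝 (∫ x, f x ∂H₀))
  tendsto_sq : Tendsto (fun n => ∫ x, f x ^ 2 ∂P n) atTop (𝓝 (∫ x, f x ^ 2 ∂H₀))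

/-- The normalized estimation error `√n (H f - P n f)`. -/
noncomputable def scaledError (P : ℕ → Measure E) (f : E → ℝ) (n : ℕ) (H : ProbabilityMeasure E) : ℝ :=
  √(n : ℝ) * (∫ x, f x ∂(H : Measure E) - ∫ x, f x ∂P n)

lemma measurable_scaledError {P : ℕ → Measure E} {f : E → ℝ} (hf : Measurable f) (n : ℕ) :
    Measurable (scaledError P f n) :=
  ((measurable_integral_coe hf).sub_const _).const_mul _

/-- An upper bound for the second moment of `scaledError P f n`: twice the bound on `n Var (H f)`
plus twice the square of `√n` times the difference of the posterior mean of `H f` and `P n f`. -/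
noncomputable def errorBound (a : Measure E) (P : ℕ → Measure E) (f : E → ℝ) (n : ℕ) : ℝ :=
  2 * (n / (n + a.real Set.univ)) * ((∫ x, f x ^ 2 ∂a) / (n + (a.real Set.univ + 1))
      + n / (n + (a.real Set.univ + 1)) * ∫ x, f x ^ 2 ∂P n)
    + 2 * (n / (n + a.real Set.univ)) * ((∫ x, f x ∂a - a.real Set.univ * ∫ x, f x ∂P n) ^ 2
      / (n + a.real Set.univ))

lemma tendsto_div_natCast_add {u : ℕ → ℝ} {l : ℝ} (hu : Tendsto u atTop (𝓝 l)) (c : ℝ) :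
    Tendsto (fun n : ℕ => u n / (n + c)) atTop (𝓝 0) :=
  hu.div_atTop (tendsto_atTop_add_const_right _ _ tendsto_natCast_atTop_atTop)

lemma tendsto_errorBound {a H₀ : Measure E} {P : ℕ → Measure E} {f : E → ℝ}
    (hf : MomentsConverge a H₀ P f) :
    Tendsto (errorBound a P f) atTop (𝓝 (2 * ∫ x, f x ^ 2 ∂H₀)) := by
  have h1 : ∀ c : ℝ, Tendsto (fun n : ℕ => (n : ℝ) / (n + c)) atTop (𝓝 1) := fun c =>
    tendsto_natCast_div_add_atTop c
  have h2 := ((h1 (a.real Set.univ)).const_mul 2).mul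
    ((tendsto_div_natCast_add (tendsto_const_nhds (x := ∫ x, f x ^ 2 ∂a))
      (a.real Set.univ + 1)).add ((h1 (a.real Set.univ + 1)).mul hf.tendsto_sq))
  have h3 := ((h1 (a.real Set.univ)).const_mul 2).mul (tendsto_div_natCast_add
    (((tendsto_const_nhds (x := ∫ x, f x ∂a)).sub
      (hf.tendsto_mean.const_mul (a.real Set.univ))).pow 2) (a.real Set.univ))
  convert h2.add h3 using 2
  · rfl
  · ring

namespace IsDirichletPosterior

variable {a H₀ : Measure E} {P : ℕ → Measure E}
  {D : ℕ → Measure (ProbabilityMeasure E)} {f : E → ℝ}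

lemma isProbabilityMeasure (h : IsDirichletPosterior a P D) {n : ℕ} (hn : 1 ≤ n) :
    IsProbabilityMeasure (D n) := (h.process n hn).isProbabilityMeasure

lemma base_ne_zero (h : IsDirichletPosterior a P D) {n : ℕ} (hn : 1 ≤ n) :
    a + (n : ENNReal) • P n ≠ 0 := by
  have := h.prob n hn
  intro h0
  have := congrArg (fun μ : Measure E => μ Set.univ) h0
  simp at this
  omega

lemma base_integral (hfa : Integrable f a) {n : ℕ} (hfP : Integrable f (P n)) :
    ∫ x, f x ∂(a + (n : ENNReal) • P n) = ∫ x, f x ∂a + n * ∫ x, f x ∂P n := by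
  rw [integral_add_measure hfa (hfP.smul_measure (ENNReal.natCast_ne_top n)),
    integral_smul_measure]
  simp

lemma memLp_base (hf : MomentsConverge a H₀ P f) {n : ℕ} (hn : 1 ≤ n) :
    MemLp f 2 (a + (n : ENNReal) • P n) :=
  (memLp_two_iff_integrable_sq hf.measurable.aestronglyMeasurable).2
    (hf.memLp_prior.integrable_sq.add_measure
      ((hf.memLp n hn).integrable_sq.smul_measure (ENNReal.natCast_ne_top n)))

variable [IsFiniteMeasure a]

lemma isFiniteMeasure_base (h : IsDirichletPosterior a P D) {n : ℕ} (hn : 1 ≤ n) :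
    IsFiniteMeasure (a + (n : ENNReal) • P n) := by
  have := h.prob n hn
  have : IsFiniteMeasure ((n : ENNReal) • P n) :=
    (P n).smul_finite (ENNReal.natCast_ne_top n)
  infer_instance

lemma base_real (h : IsDirichletPosterior a P D) {n : ℕ} (hn : 1 ≤ n) (s : Set E) :
    (a + (n : ENNReal) • P n).real s = a.real s + n * (P n).real s := by
  have := h.prob n hn
  simp [measureReal_def, ENNReal.toReal_add, ENNReal.mul_eq_top]

lemma ae_integrable (h : IsDirichletPosterior a P D) (hf : MomentsConverge a H₀ P f) {n : ℕ}
    (hn : 1 ≤ n) : ∀ᵐ H : ProbabilityMeasure E ∂D n, Integrable f (H : Measure E) := by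
  have := h.isFiniteMeasure_base hn
  exact (h.process n hn).ae_integrable (h.base_ne_zero hn)
    ((memLp_base hf hn).integrable (by norm_num))

lemma memLp_integral (h : IsDirichletPosterior a P D) (hf : MomentsConverge a H₀ P f) {n : ℕ}
    (hn : 1 ≤ n) : MemLp (fun H : ProbabilityMeasure E => ∫ x, f x ∂(H : Measure E)) 2 (D n) := by
  have := h.isFiniteMeasure_base hn
  exact (memLp_two_iff_integrable_sq (measurable_integral_coe hf.measurable).aestronglyMeasurable).2
    ((h.process n hn).integrable_integral_sq (h.base_ne_zero hn) (memLp_base hf hn))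

lemma memLp_scaledError (h : IsDirichletPosterior a P D) (hf : MomentsConverge a H₀ P f) {n : ℕ}
    (hn : 1 ≤ n) : MemLp (scaledError P f n) 2 (D n) := by
  have := h.isProbabilityMeasure hn
  exact ((h.memLp_integral hf hn).sub (memLp_const _)).const_mul _

lemma integral_scaledError_sq_le (h : IsDirichletPosterior a P D) (hf : MomentsConverge a H₀ P f)
    {n : ℕ} (hn : 1 ≤ n) : ∫ H, scaledError P f n H ^ 2 ∂D n ≤ errorBound a P f n := by
  have := h.isFiniteMeasure_base hn
  have := h.isProbabilityMeasure hn
  have := h.prob n hn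
  have hn0 : (0 : ℝ) < n := by exact_mod_cast hn
  have hA : 0 ≤ a.real Set.univ := measureReal_nonneg
  have h1 := (h.process n hn).integral_sq_sub_le (h.base_ne_zero hn) (memLp_base hf hn)
  set c := (∫ x, f x ∂(a + (n : ENNReal) • P n)) / (a + (n : ENNReal) • P n).real Set.univ with hc
  have hi : Integrable (fun H : ProbabilityMeasure E => (∫ x, f x ∂(H : Measure E) - c) ^ 2) (D n) :=
    ((h.memLp_integral hf hn).sub (memLp_const c)).integrable_sq
  calc ∫ H, scaledError P f n H ^ 2 ∂D n
      ≤ ∫ H : ProbabilityMeasure E, (2 * n * (∫ x, f x ∂(H : Measure E) - c) ^ 2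
          + 2 * n * (c - ∫ x, f x ∂P n) ^ 2) ∂D n := by
        refine integral_mono (h.memLp_scaledError hf hn).integrable_sq
          ((hi.const_mul _).add (integrable_const _)) fun H => ?_
        simp only [scaledError, mul_pow, Real.sq_sqrt hn0.le]
        have := sq_nonneg ((∫ x, f x ∂(H : Measure E) - c) - (c - ∫ x, f x ∂P n))
        nlinarith
    _ = 2 * n * ∫ H : ProbabilityMeasure E, (∫ x, f x ∂(H : Measure E) - c) ^ 2 ∂D n
          + 2 * n * (c - ∫ x, f x ∂P n) ^ 2 := by
        rw [integral_add (hi.const_mul _) (integrable_const _), integral_const_mul]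
        simp
    _ ≤ 2 * n * ((∫ x, f x ^ 2 ∂(a + (n : ENNReal) • P n))
          / ((a + (n : ENNReal) • P n).real Set.univ
            * ((a + (n : ENNReal) • P n).real Set.univ + 1)))
          + 2 * n * (c - ∫ x, f x ∂P n) ^ 2 := by gcongr
    _ = errorBound a P f n := by
        rw [hc, base_integral (hf.memLp_prior.integrable (by norm_num))
          ((hf.memLp n hn).integrable (by norm_num)), base_integral (f := fun x => f x ^ 2)
          hf.memLp_prior.integrable_sq (hf.memLp n hn).integrable_sq, h.base_real hn, errorBound]
        simp only [probReal_univ, mul_one]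
        field_simp
        ring

end IsDirichletPosterior

/-- The value of an integral over the fibre masses of a Dirichlet process, in terms of independent
gamma variables. -/
lemma IsDirichletProcess.integral_comp_fiber {F : Type*} [NormedAddCommGroup F] [NormedSpace ℝ F]
    {α : Measure E} {D : Measure (ProbabilityMeasure E)} (h : IsDirichletProcess α D) {k : ℕ}
    {π : E → Fin k} (hπ : Measurable π) {G : (Fin k → ℝ) → F} (hG : StronglyMeasurable G) :
    ∫ H : ProbabilityMeasure E, G (fun i => (H : Measure E).real (π ⁻¹' {i})) ∂D
      = ∫ y, G (fun i => y i / ∑ j, y j)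
        ∂(Measure.pi fun i => gammaLaw (α.real (π ⁻¹' {i}))) := by
  rw [← integral_map (f := G) (measurable_pi_lambda _ fun i => measurable_measureReal_coe
    (hπ (measurableSet_singleton i))).aemeasurable hG.aestronglyMeasurable, h.map_fiber hπ,
    dirichletLaw, integral_map (by fun_prop) hG.aestronglyMeasurable]

section Simple

variable {a H₀ : Measure E} {P : ℕ → Measure E}
  {D : ℕ → Measure (ProbabilityMeasure E)} {k : ℕ} {π : E → Fin k}

lemma tendsto_integral_comp_fin [IsFiniteMeasure H₀] (h : IsDirichletPosterior a P D) (hπ : Measurable π)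
    (hP : ∀ i, Tendsto (fun n => (P n).real (π ⁻¹' {i})) atTop (𝓝 (H₀.real (π ⁻¹' {i}))))
    (c : Fin k → ℝ) :
    Tendsto (fun n => ∫ x, c (π x) ∂P n) atTop (𝓝 (∫ x, c (π x) ∂H₀)) := by
  rw [integral_comp_fin hπ c H₀]
  refine (tendsto_finsetSum (f := fun i n => c i * (P n).real (π ⁻¹' {i})) Finset.univ
    fun i _ => (hP i).const_mul (c i)).congr' ?_
  filter_upwards [eventually_ge_atTop 1] with n hn
  have := h.prob n hn
  rw [integral_comp_fin hπ]

variable [IsFiniteMeasure a] [IsProbabilityMeasure H₀]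

lemma memLp_comp_fin (hπ : Measurable π) (c : Fin k → ℝ) (μ : Measure E) [IsFiniteMeasure μ] :
    MemLp (fun x => c (π x)) 2 μ :=
  MemLp.of_bound ((measurable_of_countable c).comp hπ).aestronglyMeasurable (∑ i, |c i|)
    (ae_of_all _ fun _ => Finset.single_le_sum (f := fun i => |c i|) (fun _ _ => abs_nonneg _)
      (Finset.mem_univ _))

lemma momentsConverge_comp_fin (h : IsDirichletPosterior a P D) (hπ : Measurable π)
    (hP : ∀ i, Tendsto (fun n => (P n).real (π ⁻¹' {i})) atTop (𝓝 (H₀.real (π ⁻¹' {i}))))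
    (c : Fin k → ℝ) : MomentsConverge a H₀ P (fun x => c (π x)) where
  measurable := (measurable_of_countable c).comp hπ
  memLp_prior := memLp_comp_fin hπ c a
  memLp_limit := memLp_comp_fin hπ c H₀
  memLp n hn := by
    have := h.prob n hn
    exact memLp_comp_fin hπ c (P n)
  tendsto_mean := tendsto_integral_comp_fin h hπ hP c
  tendsto_sq := tendsto_integral_comp_fin h hπ hP fun i => c i ^ 2

lemma variance_comp_fin (hπ : Measurable π) (c : Fin k → ℝ) :
    Var[fun x => c (π x); H₀]
      = ∑ i, H₀.real (π ⁻¹' {i}) * (c i - ∫ x, c (π x) ∂H₀) ^ 2 := by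
  have hc : AEMeasurable (fun x => c (π x)) H₀ := ((measurable_of_countable c).comp hπ).aemeasurable
  rw [variance_eq_integral hc,
    integral_comp_fin hπ (fun i => (c i - ∫ x, c (π x) ∂H₀) ^ 2)]
  simp_rw [mul_comm]

/-- The numerator `√n⁻¹ ∑ i, (c i - P n c) Y i` of the normalized error is asymptotically normal. -/
lemma tendsto_integral_exp_gamma_comp_fin (h : IsDirichletPosterior a P D) (hπ : Measurable π)
    (hP : ∀ i, Tendsto (fun n => (P n).real (π ⁻¹' {i})) atTop (𝓝 (H₀.real (π ⁻¹' {i}))))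
    (c : Fin k → ℝ) (t : ℝ) :
    Tendsto (fun n : ℕ => ∫ y : Fin k → ℝ, Complex.exp ((t * ∑ i,
          (c i - ∫ x, c (π x) ∂P n) / √(n : ℝ) * y i : ℝ) * Complex.I)
        ∂(Measure.pi fun i => gammaLaw ((a + (n : ENNReal) • P n).real (π ⁻¹' {i}))))
      atTop (𝓝 (Complex.exp (-(t ^ 2 * Var[fun x => c (π x); H₀] / 2 : ℝ)))) := by
  simp_rw [fun n : ℕ => integral_exp_sum_pi_gammaLaw
    (s := fun i => (a + (n : ENNReal) • P n).real (π ⁻¹' {i})) (fun i => measureReal_nonneg)]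
  set m : ℕ → ℝ := fun n => ∫ x, c (π x) ∂P n with hm
  have hmean := tendsto_integral_comp_fin h hπ hP c
  have hdiff : ∀ i, Tendsto (fun n => c i - m n) atTop (𝓝 (c i - ∫ x, c (π x) ∂H₀)) :=
    fun i => hmean.const_sub (c i)
  have hsqrt : Tendsto (fun n : ℕ => √(n : ℝ)) atTop atTop :=
    Real.tendsto_sqrt_atTop.comp tendsto_natCast_atTop_atTop
  have hd : ∀ i, Tendsto (fun n : ℕ => (c i - m n) / √(n : ℝ)) atTop (𝓝 0) :=
    fun i => (hdiff i).div_atTop hsqrt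
  have hmass : ∀ i, Tendsto (fun n : ℕ => a.real (π ⁻¹' {i}) / n + (P n).real (π ⁻¹' {i})) atTop
      (𝓝 (H₀.real (π ⁻¹' {i}))) := fun i => by
    simpa using (tendsto_const_nhds.div_atTop tendsto_natCast_atTop_atTop).add (hP i)
  refine tendsto_exp_sum_log (Eventually.of_forall fun n i => measureReal_nonneg) hd ?_ ?_ ?_ t
  · have : Tendsto (fun n : ℕ => ∑ i, a.real (π ⁻¹' {i}) * ((c i - m n) / √(n : ℝ))) atTop (𝓝 0) := by
      simpa using tendsto_finsetSum Finset.univ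
        fun i _ => (hd i).const_mul (a.real (π ⁻¹' {i}))
    refine this.congr' ?_
    filter_upwards [eventually_ge_atTop 1] with n hn
    have := h.prob n hn
    -- The `P n`-part of the sum vanishes, since `m n` is the mean of `c` under `P n`.
    have hzero : ∑ i, (P n).real (π ⁻¹' {i}) * (c i - m n) = 0 := by
      simp_rw [mul_sub, Finset.sum_sub_distrib, ← Finset.sum_mul]
      rw [← measureReal_univ_eq_sum_fiber hπ, hm]
      simp only
      rw [integral_comp_fin hπ]
      simp [mul_comm]
    simp_rw [h.base_real hn, add_mul, Finset.sum_add_distrib]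
    have : ∑ i, n * (P n).real (π ⁻¹' {i}) * ((c i - m n) / √(n : ℝ))
        = n / √(n : ℝ) * ∑ i, (P n).real (π ⁻¹' {i}) * (c i - m n) := by
      rw [Finset.mul_sum]
      exact Finset.sum_congr rfl fun i _ => by ring
    rw [this, hzero, mul_zero, add_zero]
  · rw [variance_comp_fin hπ]
    refine (tendsto_finsetSum Finset.univ fun i _ => (hmass i).mul ((hdiff i).pow 2)).congr' ?_
    filter_upwards [eventually_ge_atTop 1] with n hn
    have hn0 : (0 : ℝ) < n := by exact_mod_cast hn
    refine Finset.sum_congr rfl fun i _ => ?_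
    rw [h.base_real hn, div_pow, Real.sq_sqrt hn0.le]
    field_simp
  · have : Tendsto (fun n : ℕ => ∑ i, (a.real (π ⁻¹' {i}) / n + (P n).real (π ⁻¹' {i}))
        * |c i - m n| ^ 3 / √(n : ℝ)) atTop (𝓝 0) := by
      simpa using tendsto_finsetSum Finset.univ
        fun i _ => (((hmass i).mul ((hdiff i).abs.pow 3)).div_atTop hsqrt)
    refine this.congr' ?_
    filter_upwards [eventually_ge_atTop 1] with n hn
    have hn0 : (0 : ℝ) < n := by exact_mod_cast hn
    refine Finset.sum_congr rfl fun i _ => ?_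
    have hs : 0 < √(n : ℝ) := Real.sqrt_pos.2 hn0
    rw [h.base_real hn, abs_div, abs_of_pos hs, div_pow]
    nth_rewrite 1 [← Real.sq_sqrt hn0.le]
    nth_rewrite 3 [← Real.sq_sqrt hn0.le]
    field_simp

/-- The Bernstein–von Mises theorem for functions with finitely many values. -/
lemma tendsto_integral_exp_scaledError_comp_fin (h : IsDirichletPosterior a P D)
    (hπ : Measurable π)
    (hP : ∀ i, Tendsto (fun n => (P n).real (π ⁻¹' {i})) atTop (𝓝 (H₀.real (π ⁻¹' {i}))))
    (c : Fin k → ℝ) (t : ℝ) :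
    Tendsto (fun n : ℕ => ∫ H, Complex.exp ((t * scaledError P (fun x => c (π x)) n H : ℝ)
        * Complex.I) ∂D n)
      atTop (𝓝 (Complex.exp (-(t ^ 2 * Var[fun x => c (π x); H₀] / 2 : ℝ)))) := by
  have hf := momentsConverge_comp_fin h hπ hP c
  refine tendsto_of_tendsto_of_dist (tendsto_integral_exp_gamma_comp_fin h hπ hP c t) ?_
  set A := a.real Set.univ
  have hlim : Tendsto (fun n : ℕ => |t| * (√(errorBound a P (fun x => c (π x)) n)
      * √(((A + n) + A ^ 2) / (n : ℝ) ^ 2))) atTop (𝓝 0) := by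
    have e1 : Tendsto (fun n : ℕ => ((A + n) + A ^ 2) / (n : ℝ) ^ 2) atTop (𝓝 0) := by
      have e2 : Tendsto (fun n : ℕ => (A + A ^ 2) * ((n : ℝ)⁻¹ * (n : ℝ)⁻¹) + (n : ℝ)⁻¹) atTop
          (𝓝 ((A + A ^ 2) * (0 * 0) + 0)) :=
        ((tendsto_inv_atTop_nhds_zero_nat.mul tendsto_inv_atTop_nhds_zero_nat).const_mul _).add
          tendsto_inv_atTop_nhds_zero_nat
      simp only [mul_zero, add_zero] at e2
      refine e2.congr' ?_
      filter_upwards [eventually_ge_atTop 1] with n hn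
      have hn0 : (0 : ℝ) < n := by exact_mod_cast hn
      field_simp
      ring
    simpa using (((tendsto_errorBound hf).sqrt).mul e1.sqrt).const_mul |t|
  refine squeeze_zero' (Eventually.of_forall fun n => dist_nonneg) ?_ hlim
  filter_upwards [eventually_ge_atTop 1] with n hn
  have hn0 : (0 : ℝ) < n := by exact_mod_cast hn
  have hPn := h.prob n hn
  have hbase := h.isFiniteMeasure_base hn
  set s : Fin k → ℝ := fun i => (a + (n : ENNReal) • P n).real (π ⁻¹' {i}) with hs
  have hs0 : ∀ i, 0 ≤ s i := fun i => measureReal_nonneg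
  have hsum : ∑ i, s i = A + n := by
    rw [← measureReal_univ_eq_sum_fiber hπ, h.base_real hn]
    simp [A]
  have hγ := fun i => isProbabilityMeasure_gammaLaw (hs0 i)
  set m := ∫ x, c (π x) ∂P n with hm
  set τ : (Fin k → ℝ) → ℝ := fun p => √(n : ℝ) * (∑ i, c i * p i - m) with hτ
  set T : (Fin k → ℝ) → ℝ := fun y => τ fun i => y i / ∑ j, y j with hT
  set W : (Fin k → ℝ) → ℝ := fun y => ∑ i, (c i - m) / √(n : ℝ) * y i with hW
  have hτm : Measurable τ := by fun_prop
  have hTm : Measurable T := by fun_prop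
  have hWm : Measurable W := by fun_prop
  have herr : ∀ H : ProbabilityMeasure E, scaledError P (fun x => c (π x)) n H
      = τ fun i => (H : Measure E).real (π ⁻¹' {i}) := fun H => by
    rw [scaledError, integral_comp_fin hπ]
  have hexp : ∫ H, Complex.exp ((t * scaledError P (fun x => c (π x)) n H : ℝ) * Complex.I) ∂D n
      = ∫ y, Complex.exp ((t * T y : ℝ) * Complex.I) ∂(Measure.pi fun i => gammaLaw (s i)) := by
    simp_rw [herr]
    exact (h.process n hn).integral_comp_fiber hπ
      (G := fun p => Complex.exp ((t * τ p : ℝ) * Complex.I))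
      (Measurable.stronglyMeasurable (by fun_prop))
  have hsq : ∫ y, T y ^ 2 ∂(Measure.pi fun i => gammaLaw (s i))
      ≤ errorBound a P (fun x => c (π x)) n := by
    rw [← (h.process n hn).integral_comp_fiber hπ (G := fun p => τ p ^ 2)
      (Measurable.stronglyMeasurable (by fun_prop))]
    simp_rw [← herr]
    exact h.integral_scaledError_sq_le hf hn
  have hnn := ae_nonneg_pi_gammaLaw hs0
  have hTb : MemLp T 2 (Measure.pi fun i => gammaLaw (s i)) := by
    refine MemLp.of_bound hTm.aestronglyMeasurable (√(n : ℝ) * (∑ i, |c i| + |m|)) ?_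
    filter_upwards [hnn] with y hy
    have hS : 0 ≤ ∑ j, y j := Finset.sum_nonneg fun j _ => hy j
    simp only [hT, hτ]
    rw [Real.norm_eq_abs, abs_mul, abs_of_nonneg (Real.sqrt_nonneg _)]
    gcongr
    refine (abs_sub _ _).trans (add_le_add_left ?_ _)
    refine (Finset.abs_sum_le_sum_abs _ _).trans (Finset.sum_le_sum fun i _ => ?_)
    rw [abs_mul, abs_of_nonneg (div_nonneg (hy i) hS)]
    refine mul_le_of_le_one_right (abs_nonneg _) (div_le_one_of_le₀ ?_ hS)
    exact Finset.single_le_sum (fun j _ => hy j) (Finset.mem_univ i)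
  have hR : MemLp (fun y : Fin k → ℝ => 1 - (∑ i, y i) / n) 2
      (Measure.pi fun i => gammaLaw (s i)) := by
    simp_rw [div_eq_inv_mul]
    exact (memLp_const _).sub ((memLp_sum_pi_gammaLaw hs0).const_mul _)
  -- `W = T * S / n` with `S = ∑ i, y i`; when `S = 0` the junk value of `T` is harmless, as `W = 0`.
  have hTW : ∀ᵐ y ∂(Measure.pi fun i => gammaLaw (s i)),
      T y - W y = T y * (1 - (∑ i, y i) / n) := by
    filter_upwards [hnn] with y hy
    have hsn : 0 < √(n : ℝ) := Real.sqrt_pos.2 hn0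
    suffices W y = T y * ((∑ i, y i) / n) by rw [this]; ring
    have hW' : W y = (∑ i, c i * y i - m * ∑ i, y i) / √(n : ℝ) := by
      simp only [hW]
      rw [Finset.mul_sum, ← Finset.sum_sub_distrib, Finset.sum_div]
      exact Finset.sum_congr rfl fun i _ => by ring
    rcases (Finset.sum_nonneg fun j (_ : j ∈ Finset.univ) => hy j).eq_or_lt with hS | hS
    · have : ∀ i, y i = 0 := fun i =>
        (Finset.sum_eq_zero_iff_of_nonneg fun l _ => hy l).1 hS.symm i (Finset.mem_univ i)
      rw [hW']
      simp [this]
    · rw [hW']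
      simp only [hT, hτ]
      have : ∑ i, c i * (y i / ∑ j, y j) = (∑ i, c i * y i) / ∑ j, y j := by
        rw [Finset.sum_div]
        exact Finset.sum_congr rfl fun i _ => by ring
      rw [this, div_eq_iff hsn.ne']
      have h2 : √(n : ℝ) * √(n : ℝ) = n := Real.mul_self_sqrt hn0.le
      field_simp
      rw [sq, h2]
  have hint : Integrable (fun y => T y - W y) (Measure.pi fun i => gammaLaw (s i)) :=
    (hTb.integrable_mul hR).congr (hTW.mono fun y hy => hy.symm)
  rw [hexp, dist_comm, dist_eq_norm]
  refine (norm_integral_exp_sub_le hTm.aemeasurable hWm.aemeasurable t hint).trans ?_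
  gcongr
  calc ∫ y, |T y - W y| ∂(Measure.pi fun i => gammaLaw (s i))
      = ∫ y, |T y * (1 - (∑ i, y i) / n)| ∂(Measure.pi fun i => gammaLaw (s i)) :=
        integral_congr_ae (hTW.mono fun y hy => by simp only [hy])
    _ ≤ _ := integral_abs_mul_le_sqrt hTb hR
    _ ≤ _ := by
        rw [integral_one_sub_sum_div_sq hs0 hn0.ne', hsum, add_sub_cancel_right]
        gcongr

end Simple

end Posterior

/-! ### Asymptotic normality for square-integrable functions, and the delta method -/

section Posterior

variable {E : Type*} [MeasurableSpace E] {a H₀ : Measure E} [IsFiniteMeasure a]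
  {P : ℕ → Measure E} {D : ℕ → Measure (ProbabilityMeasure E)}

/-- Convergence of variances along a sequence converging in `L²`. -/
lemma tendsto_variance_of_tendsto_sq [IsProbabilityMeasure H₀] {f : E → ℝ} {φ : ℕ → E → ℝ} (hf : MemLp f 2 H₀)
    (hφ : ∀ j, MemLp (φ j) 2 H₀)
    (h : Tendsto (fun j => ∫ x, (f x - φ j x) ^ 2 ∂H₀) atTop (𝓝 0)) :
    Tendsto (fun j => Var[φ j; H₀]) atTop (𝓝 Var[f; H₀]) := by
  have hd : ∀ j, MemLp (fun x => f x - φ j x) 2 H₀ := fun j => hf.sub (hφ j)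
  have hsq : Tendsto (fun j => √(∫ x, (f x - φ j x) ^ 2 ∂H₀)) atTop (𝓝 0) := by
    simpa using h.sqrt
  have h1 : Tendsto (fun j => ∫ x, φ j x ∂H₀) atTop (𝓝 (∫ x, f x ∂H₀)) := by
    refine tendsto_iff_dist_tendsto_zero.2 (squeeze_zero (fun _ => dist_nonneg) (fun j => ?_) hsq)
    rw [dist_comm, Real.dist_eq, ← integral_sub (hf.integrable (by norm_num))
      ((hφ j).integrable (by norm_num))]
    exact (abs_integral_le_integral_abs).trans (integral_abs_le_sqrt (hd j))
  have h2 : Tendsto (fun j => ∫ x, φ j x ^ 2 ∂H₀) atTop (𝓝 (∫ x, f x ^ 2 ∂H₀)) := by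
    have hb : Tendsto (fun j => ∫ x, (f x - φ j x) ^ 2 ∂H₀
        + 2 * (√(∫ x, f x ^ 2 ∂H₀) * √(∫ x, (f x - φ j x) ^ 2 ∂H₀))) atTop (𝓝 0) := by
      simpa using h.add ((hsq.const_mul √(∫ x, f x ^ 2 ∂H₀)).const_mul 2)
    refine tendsto_iff_dist_tendsto_zero.2 (squeeze_zero (fun _ => dist_nonneg) (fun j => ?_) hb)
    have hm : Integrable (fun x => f x * (f x - φ j x)) H₀ := hf.integrable_mul (hd j)
    have e : ∫ x, φ j x ^ 2 ∂H₀ - ∫ x, f x ^ 2 ∂H₀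
        = ∫ x, (f x - φ j x) ^ 2 ∂H₀ - 2 * ∫ x, f x * (f x - φ j x) ∂H₀ := by
      rw [← integral_sub (hφ j).integrable_sq hf.integrable_sq, ← integral_const_mul,
        ← integral_sub (hd j).integrable_sq (hm.const_mul 2)]
      refine integral_congr_ae (ae_of_all _ fun x => ?_)
      simp only
      ring
    rw [Real.dist_eq, e]
    refine (abs_sub _ _).trans ?_
    rw [abs_of_nonneg (integral_nonneg fun x => sq_nonneg _), abs_mul, abs_two]
    gcongr
    exact abs_integral_le_integral_abs.trans (integral_abs_mul_le_sqrt hf (hd j))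
  rw [variance_eq_sub hf]
  simp_rw [fun j => variance_eq_sub (hφ j)]
  exact h2.sub (h1.pow 2)

namespace IsDirichletPosterior

/-- The Bernstein–von Mises theorem for a linear functional, in terms of characteristic functions:
the function `f` is approximated in `L²` by functions `c j ∘ π j` with finitely many values. -/
lemma tendsto_integral_exp_scaledError [IsProbabilityMeasure H₀]
    (h : IsDirichletPosterior a P D) {f : E → ℝ}
    (hf : MomentsConverge a H₀ P f) {k : ℕ → ℕ} {π : ∀ j, E → Fin (k j)}
    (hπ : ∀ j, Measurable (π j)) (c : ∀ j, Fin (k j) → ℝ)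
    (hP : ∀ j i, Tendsto (fun n => (P n).real (π j ⁻¹' {i})) atTop (𝓝 (H₀.real (π j ⁻¹' {i}))))
    (hsub : ∀ j, MomentsConverge a H₀ P (fun x => f x - c j (π j x)))
    (hlim : Tendsto (fun j => ∫ x, (f x - c j (π j x)) ^ 2 ∂H₀) atTop (𝓝 0)) (t : ℝ) :
    Tendsto (fun n : ℕ => ∫ H, Complex.exp ((t * scaledError P f n H : ℝ) * Complex.I) ∂D n)
      atTop (𝓝 (Complex.exp (-(t ^ 2 * Var[f; H₀] / 2 : ℝ)))) := by
  have hφ := fun j => momentsConverge_comp_fin h (hπ j) (hP j) (c j)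
  refine tendsto_of_tendsto_approx
    (b := fun j n => |t| * √(errorBound a P (fun x => f x - c j (π j x)) n))
    (fun j => tendsto_integral_exp_scaledError_comp_fin h (hπ j) (hP j) (c j) t)
    (fun j => ((tendsto_errorBound (hsub j)).sqrt).const_mul |t|) (fun j => ?_) ?_ ?_
  · filter_upwards [eventually_ge_atTop 1] with n hn
    have := h.isProbabilityMeasure hn
    have := h.prob n hn
    have hd : ∀ᵐ H ∂D n, scaledError P f n H - scaledError P (fun x => c j (π j x)) n H
        = scaledError P (fun x => f x - c j (π j x)) n H := by
      filter_upwards [h.ae_integrable hf hn, h.ae_integrable (hφ j) hn] with H h1 h2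
      simp only [scaledError]
      rw [integral_sub h1 h2, integral_sub ((hf.memLp n hn).integrable (by norm_num))
        (((hφ j).memLp n hn).integrable (by norm_num))]
      ring
    have hL := h.memLp_scaledError (hsub j) hn
    refine (norm_integral_exp_sub_le (measurable_scaledError hf.measurable n).aemeasurable
      (measurable_scaledError (hφ j).measurable n).aemeasurable t
      ((hL.integrable (by norm_num)).congr (hd.mono fun H hH => hH.symm))).trans ?_
    gcongr
    calc _ = ∫ H, |scaledError P (fun x => f x - c j (π j x)) n H| ∂D n :=
          integral_congr_ae (hd.mono fun H hH => by simp only [hH])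
      _ ≤ √(∫ H, scaledError P (fun x => f x - c j (π j x)) n H ^ 2 ∂D n) :=
          integral_abs_le_sqrt hL
      _ ≤ _ := by
          gcongr
          exact h.integral_scaledError_sq_le (hsub j) hn
  · simpa using ((hlim.const_mul 2).sqrt).const_mul |t|
  · have hv := tendsto_variance_of_tendsto_sq hf.memLp_limit (fun j => (hφ j).memLp_limit) hlim
    refine (Complex.continuous_exp.tendsto _).comp (Tendsto.neg ?_)
    exact (Complex.continuous_ofReal.tendsto _).comp ((hv.const_mul (t ^ 2)).div_const 2)

/-- The posterior is consistent for the mean of a function whose moments converge. -/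
lemma tendsto_measure_abs_sub_ge (h : IsDirichletPosterior a P D) {f : E → ℝ}
    (hf : MomentsConverge a H₀ P f) {δ : ℝ} (hδ : 0 < δ) :
    Tendsto (fun n => (D n).real {H : ProbabilityMeasure E |
      δ ≤ |∫ x, f x ∂(H : Measure E) - ∫ x, f x ∂H₀|}) atTop (𝓝 0) := by
  have hlim : Tendsto (fun n : ℕ => (4 / δ ^ 2) * (errorBound a P f n / n)) atTop (𝓝 0) := by
    simpa using ((tendsto_errorBound hf).div_atTop tendsto_natCast_atTop_atTop).const_mul
      (4 / δ ^ 2)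
  refine squeeze_zero' (Eventually.of_forall fun _ => measureReal_nonneg) ?_ hlim
  filter_upwards [eventually_ge_atTop 1,
    Metric.tendsto_nhds.1 hf.tendsto_mean (δ / 2) (by linarith)] with n hn hmean
  have hn0 : (0 : ℝ) < n := by exact_mod_cast hn
  have := h.isProbabilityMeasure hn
  rw [Real.dist_eq] at hmean
  have hi := (h.memLp_scaledError hf hn).integrable_sq
  -- Chebyshev's inequality.
  have hcheb := mul_meas_ge_le_integral_of_nonneg (μ := D n)
    (ae_of_all _ fun H => sq_nonneg (scaledError P f n H)) hi (n * (δ / 2) ^ 2)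
  have hsub : {H : ProbabilityMeasure E | δ ≤ |∫ x, f x ∂(H : Measure E) - ∫ x, f x ∂H₀|}
      ⊆ {H | n * (δ / 2) ^ 2 ≤ scaledError P f n H ^ 2} := by
    intro H hH
    simp only [Set.mem_ofPred_eq] at hH ⊢
    rw [scaledError, mul_pow, Real.sq_sqrt hn0.le, ← sq_abs (_ - _)]
    gcongr
    have := abs_sub_le (∫ x, f x ∂(H : Measure E)) (∫ x, f x ∂P n) (∫ x, f x ∂H₀)
    linarith
  have h1 := measureReal_mono (μ := D n) hsub
  have h2 := h.integral_scaledError_sq_le hf hn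
  have h3 : n * (δ / 2) ^ 2 * (D n).real
      {H : ProbabilityMeasure E | δ ≤ |∫ x, f x ∂(H : Measure E) - ∫ x, f x ∂H₀|}
      ≤ errorBound a P f n := by
    refine le_trans ?_ (hcheb.trans h2)
    gcongr
  rw [div_mul_div_comm, le_div_iff₀ (by positivity)]
  nlinarith

/-- The delta method: a functional `F (H f₁, …, H f_r)` may be replaced by its linearization
at the limit. Strict differentiability is what allows the centring at `P n` instead of `H₀`. -/
lemma tendsto_integral_exp_delta (h : IsDirichletPosterior a P D) {ι : Type*} [Fintype ι]
    {f : ι → E → ℝ} (hf : ∀ i, MomentsConverge a H₀ P (f i)) {F : (ι → ℝ) → ℝ}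
    {F' : (ι → ℝ) →L[ℝ] ℝ} (hFm : Measurable F)
    (hF : HasStrictFDerivAt F F' (fun i => ∫ x, f i x ∂H₀)) (t : ℝ) :
    Tendsto (fun n : ℕ =>
      ∫ H : ProbabilityMeasure E, Complex.exp ((t * (√(n : ℝ) *
          (F (fun i => ∫ x, f i x ∂(H : Measure E)) - F (fun i => ∫ x, f i x ∂P n))) : ℝ)
          * Complex.I) ∂D n
      - ∫ H, Complex.exp ((t * F' (fun i => scaledError P (f i) n H) : ℝ) * Complex.I) ∂D n)
      atTop (𝓝 0) := by
  set θ : ProbabilityMeasure E → ι → ℝ := fun H i => ∫ x, f i x ∂(H : Measure E) with hθ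
  set θn : ℕ → ι → ℝ := fun n i => ∫ x, f i x ∂P n with hθn
  set θ₀ : ι → ℝ := fun i => ∫ x, f i x ∂H₀ with hθ₀
  have hθm : Measurable θ := measurable_pi_lambda _ fun i => measurable_integral_coe (hf i).measurable
  have hθnlim : Tendsto θn atTop (𝓝 θ₀) := tendsto_pi_nhds.2 fun i => (hf i).tendsto_mean
  set C : ℝ := ∑ i, √(2 * ∫ x, f i x ^ 2 ∂H₀) with hC
  have hC0 : 0 ≤ C := Finset.sum_nonneg fun i _ => Real.sqrt_nonneg _
  rw [Metric.tendsto_nhds]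
  intro ε hε
  obtain ⟨η, hη, hηε⟩ : ∃ η : ℝ, 0 < η ∧ |t| * (η * C) < ε := by
    refine ⟨ε / (|t| * C + 1), by positivity, ?_⟩
    rw [show |t| * (ε / (|t| * C + 1) * C) = ε * ((|t| * C) / (|t| * C + 1)) by ring]
    refine mul_lt_of_lt_one_right hε ((div_lt_one (by positivity)).2 (by linarith))
  have hlin := (hasStrictFDerivAt_iff_isLittleO.1 hF).def hη
  rw [nhds_prod_eq] at hlin
  obtain ⟨δ, hδ, hball⟩ : ∃ δ > 0, ∀ u v, dist u θ₀ < δ → dist v θ₀ < δ →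
      ‖F u - F v - F' (u - v)‖ ≤ η * ‖u - v‖ := by
    rw [← nhds_prod_eq, Metric.eventually_nhds_iff] at hlin
    obtain ⟨δ, hδ, h1⟩ := hlin
    exact ⟨δ, hδ, fun u v hu hv => h1 (y := (u, v)) (max_lt hu hv)⟩
  set b : ℕ → ℝ := fun n => |t| * (η * ∑ i, √(errorBound a P (f i) n))
    + 2 * ∑ i, (D n).real {H : ProbabilityMeasure E | δ ≤ |θ H i - θ₀ i|} with hb
  have hblim : Tendsto b atTop (𝓝 (|t| * (η * C))) := by
    have e1 := ((tendsto_finsetSum Finset.univ fun i _ =>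
      (tendsto_errorBound (hf i)).sqrt).const_mul η).const_mul |t|
    have e2 := (tendsto_finsetSum Finset.univ fun i _ =>
      h.tendsto_measure_abs_sub_ge (hf i) hδ).const_mul 2
    simpa only [Finset.sum_const_zero, mul_zero, add_zero] using e1.add e2
  filter_upwards [hblim.eventually (gt_mem_nhds hηε), eventually_ge_atTop 1,
    Metric.tendsto_nhds.1 hθnlim δ hδ] with n hbn hn hθnδ
  have := h.isProbabilityMeasure hn
  rw [dist_zero_right]
  refine lt_of_le_of_lt ?_ hbn
  have hm1 : Measurable fun H => √(n : ℝ) * (F (θ H) - F (θn n)) :=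
    ((hFm.comp hθm).sub_const _).const_mul _
  have hm2 : Measurable fun H => F' (fun i => scaledError P (f i) n H) :=
    F'.measurable.comp (measurable_pi_lambda _ fun i => measurable_scaledError (hf i).measurable n)
  rw [← integral_sub (integrable_exp_mul_I (hm1.const_mul t).aemeasurable)
    (integrable_exp_mul_I (hm2.const_mul t).aemeasurable)]
  have hbad : ∀ i, MeasurableSet {H : ProbabilityMeasure E | δ ≤ |θ H i - θ₀ i|} := fun i =>
    measurableSet_le measurable_const
      (((measurable_pi_apply i).comp hθm).sub_const _).abs
  have hL1 : ∀ i, Integrable (fun H => |scaledError P (f i) n H|) (D n) := fun i =>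
    ((h.memLp_scaledError (hf i) hn).integrable (by norm_num)).abs
  have hind : ∀ i, Integrable ({H : ProbabilityMeasure E | δ ≤ |θ H i - θ₀ i|}.indicator
      (1 : ProbabilityMeasure E → ℝ)) (D n) := fun i =>
    (integrable_const (1 : ℝ)).indicator (hbad i)
  calc _ ≤ ∫ H, (|t| * (η * ∑ i, |scaledError P (f i) n H|)
        + 2 * ∑ i, {H : ProbabilityMeasure E | δ ≤ |θ H i - θ₀ i|}.indicator 1 H) ∂D n := by
        refine norm_integral_le_of_norm_le (Integrable.add
          (((integrable_finsetSum _ fun i _ => hL1 i).const_mul η).const_mul |t|)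
          ((integrable_finsetSum _ fun i _ => hind i).const_mul 2)) (ae_of_all _ fun H => ?_)
        have hs1 : 0 ≤ |t| * (η * ∑ i, |scaledError P (f i) n H|) := by positivity
        have hs2 : ∀ i, 0 ≤ {H : ProbabilityMeasure E | δ ≤ |θ H i - θ₀ i|}.indicator
            (1 : ProbabilityMeasure E → ℝ) H := fun i =>
          Set.indicator_nonneg (fun _ _ => zero_le_one) _
        -- Far from the limit the integrand is at most `2`; close to it, strict differentiability applies.
        by_cases hH : ∃ i, δ ≤ |θ H i - θ₀ i|
        · obtain ⟨i, hi⟩ := hH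
          have e1 : (1 : ℝ) ≤ ∑ i, {H : ProbabilityMeasure E | δ ≤ |θ H i - θ₀ i|}.indicator
              (1 : ProbabilityMeasure E → ℝ) H := by
            refine le_trans ?_ (Finset.single_le_sum (fun i _ => hs2 i) (Finset.mem_univ i))
            rw [Set.indicator_of_mem (by exact hi)]
            rfl
          refine (norm_sub_le _ _).trans ?_
          rw [Complex.norm_exp_ofReal_mul_I, Complex.norm_exp_ofReal_mul_I]
          linarith
        · push Not at hH
          have hclose : dist (θ H) θ₀ < δ := (dist_pi_lt_iff hδ).2 fun i => by
            rw [Real.dist_eq]; exact hH i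
          have e1 := hball (θ H) (θn n) hclose hθnδ
          have e2 : (fun i => scaledError P (f i) n H) = √(n : ℝ) • (θ H - θn n) := by
            ext i
            simp [scaledError, hθ, hθn]
          have e3 : √(n : ℝ) * ‖θ H - θn n‖ ≤ ∑ i, |scaledError P (f i) n H| := by
            rw [← Real.norm_of_nonneg (Real.sqrt_nonneg (n : ℝ)), ← norm_smul, ← e2]
            refine (pi_norm_le_iff_of_nonneg (by positivity)).2 fun i => ?_
            exact Finset.single_le_sum (f := fun i => |scaledError P (f i) n H|)
              (fun _ _ => abs_nonneg _) (Finset.mem_univ i)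
          refine (norm_exp_mul_I_sub_le _ _).trans ?_
          refine le_trans ?_ (le_add_of_nonneg_right (mul_nonneg zero_le_two
            (Finset.sum_nonneg fun i _ => hs2 i)))
          rw [← mul_sub, abs_mul, e2, map_smul, smul_eq_mul, ← mul_sub, abs_mul,
            abs_of_nonneg (Real.sqrt_nonneg _)]
          refine mul_le_mul_of_nonneg_left ?_ (abs_nonneg t)
          rw [Real.norm_eq_abs] at e1
          calc √(n : ℝ) * |F (θ H) - F (θn n) - F' (θ H - θn n)|
              ≤ √(n : ℝ) * (η * ‖θ H - θn n‖) := by gcongr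
            _ = η * (√(n : ℝ) * ‖θ H - θn n‖) := by ring
            _ ≤ _ := by gcongr
    _ = |t| * (η * ∑ i, ∫ H, |scaledError P (f i) n H| ∂D n)
        + 2 * ∑ i, (D n).real {H : ProbabilityMeasure E | δ ≤ |θ H i - θ₀ i|} := by
        rw [integral_add (((integrable_finsetSum _ fun i _ => hL1 i).const_mul η).const_mul |t|)
          ((integrable_finsetSum _ fun i _ => hind i).const_mul 2), integral_const_mul,
          integral_const_mul, integral_const_mul, integral_finsetSum _ fun i _ => hL1 i,
          integral_finsetSum _ fun i _ => hind i]
        simp_rw [fun i => integral_indicator_one (μ := D n) (hbad i)]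
    _ ≤ b n := by
        simp only [hb]
        gcongr with i
        refine (integral_abs_le_sqrt (h.memLp_scaledError (hf i) hn)).trans ?_
        gcongr
        exact h.integral_scaledError_sq_le (hf i) hn

end IsDirichletPosterior

end Posterior

/-! ### The bounded Lipschitz distance -/

section BoundedLipschitz

lemma blDist_nonneg (μ ν : Measure ℝ) : 0 ≤ blDist μ ν :=
  Real.iSup_nonneg fun _ => abs_nonneg _

/-- A bounded Lipschitz function has nearby means under measures at a small Lévy–Prokhorov distance:
the `ε`-thickening of a level set `{t ≤ f}` lies in `{t ≤ f + ε}`. -/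
lemma integral_le_add_of_levyProkhorovEDist_lt {μ ν : Measure ℝ} [IsProbabilityMeasure μ]
    [IsProbabilityMeasure ν] {ε : ℝ} (hε : 0 < ε)
    (hμν : levyProkhorovEDist μ ν < ENNReal.ofReal ε) {h : ℝ → ℝ} (hb : ∀ z, |h z| ≤ 1)
    (hL : LipschitzWith 1 h) : ∫ z, h z ∂μ ≤ ∫ z, h z ∂ν + 3 * ε := by
  -- Adding `1` makes the function nonnegative, as the layer cake formula requires.
  let f : BoundedContinuousFunction ℝ ℝ := BoundedContinuousFunction.ofNormedAddCommGroup
    (fun z => h z + 1) (hL.continuous.add continuous_const) 2 fun z => by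
      refine (norm_add_le _ _).trans ?_
      rw [Real.norm_eq_abs, norm_one]
      linarith [hb z]
  let g : BoundedContinuousFunction ℝ ℝ := BoundedContinuousFunction.ofNormedAddCommGroup
    (fun z => h z + 1 + ε) ((hL.continuous.add continuous_const).add continuous_const) (2 + ε)
    fun z => by
      have := abs_le.1 (hb z)
      rw [Real.norm_of_nonneg (by linarith)]
      linarith
  have hf : ∀ z, f z = h z + 1 := fun z => rfl
  have hg : ∀ z, g z = h z + 1 + ε := fun z => rfl
  have hf0 : ∀ z, 0 ≤ f z := fun z => by
    have := abs_le.1 (hb z)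
    rw [hf]
    linarith
  have hg0 : ∀ z, 0 ≤ g z := fun z => by
    have := hf0 z
    rw [hf] at this
    rw [hg]
    linarith
  have hfn : ‖f‖ ≤ 2 := BoundedContinuousFunction.norm_ofNormedAddCommGroup_le _ (by norm_num) _
  have hfg : ‖f‖ ≤ ‖g‖ := by
    refine (BoundedContinuousFunction.norm_le (norm_nonneg _)).2 fun z => ?_
    refine le_trans ?_ (g.norm_coe_le_norm z)
    rw [Real.norm_of_nonneg (hf0 z), Real.norm_of_nonneg (hg0 z), hf, hg]
    linarith
  have hint : ∀ (ρ : Measure ℝ) [IsProbabilityMeasure ρ], Integrable h ρ := fun ρ _ =>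
    Integrable.of_bound hL.continuous.aestronglyMeasurable 1 (ae_of_all _ hb)
  have h1 := BoundedContinuousFunction.integral_le_of_levyProkhorovEDist_lt μ ν hε hμν f
    (ae_of_all _ hf0)
  have h2 : ∫ t in Set.Ioc 0 ‖f‖, ν.real (Metric.thickening ε {z | t ≤ f z})
      ≤ ∫ t in Set.Ioc 0 ‖g‖, ν.real {z | t ≤ g z} := by
    have hgi : IntegrableOn (fun t => ν.real {z | t ≤ g z}) (Set.Ioc 0 ‖g‖) := by
      refine Measure.integrableOn_of_bounded (M := 1) measure_Ioc_lt_top.ne ?_ ?_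
      · refine (Antitone.measurable fun s t hst => ?_).aestronglyMeasurable
        exact measureReal_mono fun z hz => le_trans hst hz
      · refine ae_of_all _ fun t => ?_
        rw [Real.norm_of_nonneg measureReal_nonneg]
        exact measureReal_le_one
    refine le_trans (integral_mono_of_nonneg (ae_of_all _ fun _ => measureReal_nonneg)
      (hgi.mono_set (Set.Ioc_subset_Ioc_right hfg)) (ae_of_all _ fun t => ?_))
      (setIntegral_mono_set hgi (ae_of_all _ fun _ => measureReal_nonneg)
        (Set.Ioc_subset_Ioc_right hfg).eventuallyLE)
    refine measureReal_mono fun z hz => ?_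
    obtain ⟨w, hw, hzw⟩ := Metric.mem_thickening_iff.1 hz
    have h3 := hL.dist_le_mul w z
    rw [NNReal.coe_one, one_mul, Real.dist_eq] at h3
    have h4 := le_abs_self (h w - h z)
    have h5 : t ≤ h w + 1 := hw
    rw [dist_comm] at hzw
    change t ≤ h z + 1 + ε
    linarith
  rw [← BoundedContinuousFunction.integral_eq_integral_meas_le g ν (ae_of_all _ hg0)] at h2
  have h3 : ∫ z, f z ∂μ = ∫ z, h z ∂μ + 1 := by
    simp_rw [hf]
    rw [integral_add (hint μ) (integrable_const _)]
    simp
  have h4 : ∫ z, g z ∂ν = ∫ z, h z ∂ν + 1 + ε := by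
    simp_rw [hg, add_assoc]
    rw [integral_add (hint ν) (integrable_const _)]
    simp
  nlinarith

/-- Weak convergence on the line is convergence in the bounded Lipschitz distance. -/
lemma tendsto_blDist {μ : ℕ → ProbabilityMeasure ℝ} {ν : ProbabilityMeasure ℝ}
    (h : Tendsto μ atTop (𝓝 ν)) :
    Tendsto (fun n => blDist (μ n : Measure ℝ) ν) atTop (𝓝 0) := by
  have h1 : Tendsto (fun n => edist (LevyProkhorov.ofMeasure (μ n)) (LevyProkhorov.ofMeasure ν))
      atTop (𝓝 0) :=
    tendsto_iff_edist_tendsto_0.1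
      ((LevyProkhorov.continuous_ofMeasure_probabilityMeasure.tendsto ν).comp h)
  rw [Metric.tendsto_nhds]
  intro ε hε
  filter_upwards [h1.eventually (gt_mem_nhds (show (0 : ENNReal) < ENNReal.ofReal (ε / 4) by
    simpa using by linarith))] with n hn
  rw [LevyProkhorov.edist_probabilityMeasure_def] at hn
  rw [Real.dist_eq, sub_zero, abs_of_nonneg (blDist_nonneg _ _)]
  have : Nonempty {h : ℝ → ℝ // (∀ z, |h z| ≤ 1) ∧ LipschitzWith 1 h} :=
    ⟨⟨fun _ => 0, by simp, LipschitzWith.const' 0⟩⟩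
  refine lt_of_le_of_lt (ciSup_le fun f => ?_) (show 3 * (ε / 4) < ε by linarith)
  rw [abs_sub_le_iff]
  constructor
  · linarith [integral_le_add_of_levyProkhorovEDist_lt (by linarith) hn f.2.1 f.2.2]
  · change levyProkhorovEDist (μ n : Measure ℝ) ν < _ at hn
    rw [levyProkhorovEDist_comm] at hn
    linarith [integral_le_add_of_levyProkhorovEDist_lt (by linarith) hn f.2.1 f.2.2]

/-- Lévy's continuity theorem for the bounded Lipschitz distance. The measure `μ 0` is irrelevant. -/
lemma tendsto_blDist_of_tendsto_charFun {μ : ℕ → Measure ℝ} {ν : Measure ℝ}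
    [IsProbabilityMeasure ν] (hμ : ∀ n, 1 ≤ n → IsProbabilityMeasure (μ n))
    (h : ∀ t, Tendsto (fun n => charFun (μ n) t) atTop (𝓝 (charFun ν t))) :
    Tendsto (fun n => blDist (μ n) ν) atTop (𝓝 0) := by
  rw [← tendsto_add_atTop_iff_nat 1]
  refine tendsto_blDist (μ := fun n => ⟨μ (n + 1), hμ (n + 1) (by omega)⟩) (ν := ⟨ν, inferInstance⟩)
    (ProbabilityMeasure.tendsto_of_tendsto_charFun fun t => ?_)
  exact (tendsto_add_atTop_iff_nat 1).2 (h t)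

end BoundedLipschitz

/-! ### Empirical measures of an i.i.d. sample -/

section Empirical

variable {E : Type*} [MeasurableSpace E]

lemma isProbabilityMeasure_empiricalMeasure {n : ℕ} (hn : 1 ≤ n) (x : Fin n → E) :
    IsProbabilityMeasure (empiricalMeasure x) := by
  refine ⟨?_⟩
  have hn0 : (n : ENNReal) ≠ 0 := by exact_mod_cast (by omega : n ≠ 0)
  simp [empiricalMeasure, ENNReal.inv_mul_cancel hn0]

lemma integrable_empiricalMeasure {f : E → ℝ} (hf : Measurable f) {n : ℕ} (hn : 1 ≤ n)
    (x : Fin n → E) : Integrable f (empiricalMeasure x) := by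
  refine Integrable.smul_measure ?_ (by simp; omega)
  refine integrable_finsetSum_measure.2 fun i _ => ?_
  exact integrable_dirac' hf.stronglyMeasurable (by simp)

lemma integral_empiricalMeasure {f : E → ℝ} (hf : Measurable f) {n : ℕ} (x : Fin n → E) :
    ∫ z, f z ∂empiricalMeasure x = (∑ i, f (x i)) / n := by
  rw [empiricalMeasure, integral_smul_measure, integral_finsetSum_measure fun i _ =>
    integrable_dirac' hf.stronglyMeasurable (by simp)]
  simp_rw [fun i => integral_dirac' f (x i) hf.stronglyMeasurable]
  simp [div_eq_inv_mul]

lemma memLp_empiricalMeasure {f : E → ℝ} (hf : Measurable f) {n : ℕ} (hn : 1 ≤ n)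
    (x : Fin n → E) : MemLp f 2 (empiricalMeasure x) :=
  (memLp_two_iff_integrable_sq hf.aestronglyMeasurable).2
    (integrable_empiricalMeasure (hf.pow_const 2) hn x)

/-- The strong law of large numbers for the empirical measures of an i.i.d. sequence. -/
lemma ae_tendsto_integral_empiricalMeasure {H₀ : Measure E} [IsProbabilityMeasure H₀] {f : E → ℝ}
    (hf : Measurable f) (hint : Integrable f H₀) :
    ∀ᵐ x : ℕ → E ∂(Measure.infinitePi fun _ : ℕ => H₀),
      Tendsto (fun n : ℕ => ∫ z, f z ∂empiricalMeasure fun i : Fin n => x i) atTop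
        (𝓝 (∫ z, f z ∂H₀)) := by
  have hmp : ∀ i, MeasurePreserving (fun x : ℕ → E => x i) (Measure.infinitePi fun _ : ℕ => H₀) H₀ :=
    measurePreserving_eval_infinitePi (fun _ : ℕ => H₀)
  have hmeas : ∀ i : ℕ, AEMeasurable (fun x : ℕ → E => f (x i))
      (Measure.infinitePi fun _ : ℕ => H₀) :=
    fun i => (hf.comp (measurable_pi_apply i)).aemeasurable
  have hmap : ∀ i : ℕ, Measure.map (fun x : ℕ → E => f (x i)) (Measure.infinitePi fun _ => H₀)
      = H₀.map f := fun i => by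
    conv_rhs => rw [← (hmp i).map_eq]
    rw [Measure.map_map hf (measurable_pi_apply i)]
    rfl
  have h := strong_law_ae_real (μ := Measure.infinitePi fun _ : ℕ => H₀)
    (fun i (x : ℕ → E) => f (x i)) ((hmp 0).integrable_comp_of_integrable hint)
    (fun i j hij => (iIndepFun_infinitePi (P := fun _ : ℕ => H₀) (X := fun _ => f)
      fun _ => hf).indepFun hij)
    (fun i => ⟨hmeas i, hmeas 0, by rw [hmap, hmap]⟩)
  have hmean : ∫ x : ℕ → E, f (x 0) ∂(Measure.infinitePi fun _ : ℕ => H₀) = ∫ z, f z ∂H₀ := by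
    conv_rhs => rw [← (hmp 0).map_eq]
    exact (integral_map (measurable_pi_apply 0).aemeasurable hf.aestronglyMeasurable).symm
  filter_upwards [h] with x hx
  rw [hmean] at hx
  refine hx.congr fun n => ?_
  rw [integral_empiricalMeasure hf, Fin.sum_univ_eq_sum_range fun i => f (x i)]

lemma ae_momentsConverge {a H₀ : Measure E} [IsProbabilityMeasure H₀] {f : E → ℝ}
    (hf : Measurable f) (ha : MemLp f 2 a) (hH : MemLp f 2 H₀) :
    ∀ᵐ x : ℕ → E ∂(Measure.infinitePi fun _ : ℕ => H₀),
      MomentsConverge a H₀ (fun n => empiricalMeasure fun i : Fin n => x i) f := by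
  filter_upwards [ae_tendsto_integral_empiricalMeasure hf (hH.integrable (by norm_num)),
    ae_tendsto_integral_empiricalMeasure (hf.pow_const 2) hH.integrable_sq] with x h1 h2
  exact ⟨hf, ha, hH, fun n hn => memLp_empiricalMeasure hf hn _, h1, h2⟩

lemma MeasureTheory.SimpleFunc.exists_eq_comp_fin (φ : SimpleFunc E ℝ) :
    ∃ (k : ℕ) (π : E → Fin k) (c : Fin k → ℝ), Measurable π ∧ ∀ x, φ x = c (π x) := by
  let e := Fintype.equivFin φ.range
  refine ⟨_, fun x => e ⟨φ x, φ.mem_range_self x⟩, fun i => e.symm i, ?_, fun x => by simp⟩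
  exact (measurable_of_countable e).comp (φ.measurable.subtype_mk)

/-- For almost every sample, the posterior law of `√n (H f - ℍₙ f)` is asymptotically normal. -/
lemma ae_tendsto_integral_exp_scaledError {a H₀ : Measure E} [IsFiniteMeasure a]
    [IsProbabilityMeasure H₀]
    {D : (n : ℕ) → (Fin n → E) → Measure (ProbabilityMeasure E)}
    (hD : ∀ n : ℕ, 1 ≤ n → ∀ x : Fin n → E,
      IsDirichletProcess (a + (n : ENNReal) • empiricalMeasure x) (D n x))
    {f : E → ℝ} (hf : Measurable f) (ha : MemLp f 2 a) (hH : MemLp f 2 H₀) :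
    ∀ᵐ x : ℕ → E ∂(Measure.infinitePi fun _ : ℕ => H₀), ∀ t : ℝ,
      Tendsto (fun n : ℕ => ∫ H, Complex.exp ((t * scaledError
          (fun n => empiricalMeasure fun i : Fin n => x i) f n H : ℝ) * Complex.I)
          ∂(D n fun i => x i))
        atTop (𝓝 (Complex.exp (-(t ^ 2 * Var[f; H₀] / 2 : ℝ)))) := by
  have happrox : ∀ j : ℕ, ∃ (k : ℕ) (π : E → Fin k) (c : Fin k → ℝ), Measurable π ∧
      ∫ x, (f x - c (π x)) ^ 2 ∂H₀ ≤ (1 / ((j : ℝ) + 1)) ^ 2 := fun j => by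
    obtain ⟨φ, h1, h2⟩ := hH.exists_simpleFunc_eLpNorm_sub_lt (by norm_num)
      (ε := ENNReal.ofReal (1 / ((j : ℝ) + 1))) (by simp; positivity)
    obtain ⟨k, π, c, hπ, hφ⟩ := SimpleFunc.exists_eq_comp_fin φ
    refine ⟨k, π, c, hπ, ?_⟩
    have h3 : MemLp (fun x => f x - c (π x)) 2 H₀ := hH.sub (memLp_comp_fin hπ c H₀)
    have h4 : (f - ⇑φ) = fun x => f x - c (π x) := by
      ext x
      simp [hφ]
    rw [h4, h3.eLpNorm_eq_integral_rpow_norm (by norm_num) (by norm_num),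
      ENNReal.ofReal_lt_ofReal_iff (by positivity)] at h1
    simp only [ENNReal.toReal_ofNat, Real.rpow_ofNat, Real.norm_eq_abs, sq_abs] at h1
    rw [← one_div, ← Real.sqrt_eq_rpow] at h1
    exact ((Real.sqrt_le_left (by positivity)).1 h1.le)
  choose k π c hπ hlim using happrox
  have hfib : ∀ᵐ x : ℕ → E ∂(Measure.infinitePi fun _ : ℕ => H₀), ∀ j i,
      Tendsto (fun n : ℕ => (empiricalMeasure fun i : Fin n => x i).real (π j ⁻¹' {i})) atTop
        (𝓝 (H₀.real (π j ⁻¹' {i}))) := by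
    refine ae_all_iff.2 fun j => ae_all_iff.2 fun i => ?_
    have hm := hπ j (measurableSet_singleton i)
    have := ae_tendsto_integral_empiricalMeasure (H₀ := H₀)
      (f := (π j ⁻¹' {i}).indicator 1) (measurable_one.indicator hm)
      ((integrable_const (1 : ℝ)).indicator hm)
    simpa only [integral_indicator_one hm] using this
  have hsub : ∀ᵐ x : ℕ → E ∂(Measure.infinitePi fun _ : ℕ => H₀), ∀ j,
      MomentsConverge a H₀ (fun n => empiricalMeasure fun i : Fin n => x i)
        (fun z => f z - c j (π j z)) :=
    ae_all_iff.2 fun j => ae_momentsConverge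
      (hf.sub ((measurable_of_countable (c j)).comp (hπ j)))
      (ha.sub (memLp_comp_fin (hπ j) (c j) a)) (hH.sub (memLp_comp_fin (hπ j) (c j) H₀))
  have hlim0 : Tendsto (fun j => ∫ x, (f x - c j (π j x)) ^ 2 ∂H₀) atTop (𝓝 0) :=
    squeeze_zero (fun j => integral_nonneg fun _ => sq_nonneg _) hlim
      (by simpa using (tendsto_one_div_add_atTop_nhds_zero_nat (𝕜 := ℝ)).pow 2)
  filter_upwards [hfib, hsub, ae_momentsConverge hf ha hH] with x h1 h2 h3 t
  have hpost : IsDirichletPosterior a (fun n => empiricalMeasure fun i : Fin n => x i)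
      (fun n => D n fun i => x i) :=
    ⟨fun n hn => isProbabilityMeasure_empiricalMeasure hn _, fun n hn => hD n hn _⟩
  exact hpost.tendsto_integral_exp_scaledError h3 hπ c h1 h2 hlim0 t

end Empirical

/-! ### Brownian bridges -/

section BrownianBridge

variable {E Ω ι : Type*} [MeasurableSpace E] [MeasurableSpace Ω] [Fintype ι] {Q : Measure E}
  [IsProbabilityMeasure Q] {P : Measure Ω} {B : (E → ℝ) → Ω → ℝ}

/-- A linear combination of coordinates of a Brownian bridge is normal, with the variance of the
same linear combination of the indexing functions. -/
lemma IsBrownianBridge.hasLaw_sum [IsProbabilityMeasure P] (hB : IsBrownianBridge Q P B)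
    {f : ι → E → ℝ} (hf : ∀ i, MemLp (f i) 2 Q) (w : ι → ℝ) :
    HasLaw (fun ω => ∑ i, w i * B (f i) ω)
      (gaussianReal 0 (Var[fun x => ∑ i, w i * f i x; Q]).toNNReal) P := by
  have hg : IsGaussianProcess (fun i => B (f i)) P :=
    hB.gaussian.comp_right fun i => (⟨f i, hf i⟩ : {f : E → ℝ // MemLp f 2 Q})
  have hlaw : HasGaussianLaw (fun ω => ∑ i, w i * B (f i) ω) P := by
    simpa using (hg.smul w).hasGaussianLaw_fun_sum (I := Finset.univ)
  have hB2 : ∀ i, MemLp (B (f i)) 2 P := fun i => (hg.hasGaussianLaw_eval i).memLp_two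
  refine ⟨hlaw.aemeasurable, ?_⟩
  rw [hlaw.map_eq_gaussianReal]
  congr 2
  · rw [integral_finsetSum _ fun i _ => ((hB2 i).integrable (by norm_num)).const_mul _]
    simp [integral_const_mul, hB.mean_zero _ (hf _)]
  · rw [variance_fun_sum' fun i _ => (hB2 i).const_mul (w i),
      variance_fun_sum' fun i _ => (hf i).const_mul (w i)]
    refine Finset.sum_congr rfl fun i _ => Finset.sum_congr rfl fun j _ => ?_
    rw [covariance_const_mul_left, covariance_const_mul_right, covariance_const_mul_left,
      covariance_const_mul_right, hB.covariance _ _ (hf i) (hf j), covariance_eq_sub (hf i) (hf j)]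
    rfl

end BrownianBridge

/-! ### The missing outcomes model -/

namespace Obs

variable {Y : Type*} [MeasurableSpace Y] {g q : Y → ℝ}

lemma measurableSet_star : MeasurableSet ({star} : Set (Obs Y)) := by
  have : ({star} : Set (Obs Y)) = Set.range Sum.inr := by
    ext x
    rcases x with y | u <;> simp [star]
  rw [this]
  exact measurableSet_range_inr

lemma measurable_ext {f : Y → ℝ} (hf : Measurable f) : Measurable (ext f) :=
  hf.sumElim measurable_const

lemma integral_starInd (H : Measure (Obs Y)) : ∫ x, starInd x ∂H = H.real {star} := by
  rw [starInd, integral_indicator_const _ measurableSet_star, smul_eq_mul, mul_one]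

/-- The functions of one observation whose `H`-means determine `χ(H, q)`. -/
noncomputable def coordFn (g q : Y → ℝ) : Fin 4 → Obs Y → ℝ :=
  ![starInd, mulExpFn g q, expFn q, ext g]

/-- The function of the four means through which `χ` factors. -/
noncomputable def chiFn (v : Fin 4 → ℝ) : ℝ := v 1 * v 0 / v 2 + v 3

/-- The partial derivatives of `chiFn` at the four means under `H₀`. -/
noncomputable def chiWeight (g q : Y → ℝ) (H₀ : Measure (Obs Y)) : Fin 4 → ℝ :=
  ![(∫ x, mulExpFn g q x ∂H₀) / (∫ x, expFn q x ∂H₀),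
    H₀.real {star} / (∫ x, expFn q x ∂H₀),
    -(H₀.real {star} * (∫ x, mulExpFn g q x ∂H₀) / (∫ x, expFn q x ∂H₀) ^ 2), 1]

lemma chi_eq_chiFn (H : Measure (Obs Y)) : chi g q H = chiFn fun i => ∫ x, coordFn g q i x ∂H := by
  simp [chi, chiFn, coordFn, integral_starInd]

lemma measurable_chiFn : Measurable chiFn := by
  unfold chiFn
  fun_prop

lemma limitFn_eq_sum (H₀ : Measure (Obs Y)) (x : Obs Y) :
    limitFn g q H₀ x = ∑ i, chiWeight g q H₀ i * coordFn g q i x := by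
  simp [limitFn, chiWeight, coordFn, Fin.sum_univ_four]
  ring

lemma limitVar_eq_sum {Ω : Type*} (H₀ : Measure (Obs Y)) (B : (Obs Y → ℝ) → Ω → ℝ) (ω : Ω) :
    limitVar g q H₀ B ω = ∑ i, chiWeight g q H₀ i * B (coordFn g q i) ω := by
  simp [limitVar, chiWeight, coordFn, Fin.sum_univ_four]
  ring

/-- The linear functional on `Fin 4 → ℝ` with given coefficients. -/
noncomputable def sumCLM (w : Fin 4 → ℝ) : (Fin 4 → ℝ) →L[ℝ] ℝ :=
  ∑ i, w i • ContinuousLinearMap.proj (R := ℝ) (φ := fun _ : Fin 4 => ℝ) i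

lemma sumCLM_apply (w u : Fin 4 → ℝ) : sumCLM w u = ∑ i, w i * u i := by
  simp [sumCLM]

lemma hasStrictFDerivAt_chiFn (H₀ : Measure (Obs Y)) (h : ∫ x, expFn q x ∂H₀ ≠ 0) :
    HasStrictFDerivAt chiFn (sumCLM (chiWeight g q H₀)) (fun i => ∫ x, coordFn g q i x ∂H₀) := by
  set v : Fin 4 → ℝ := fun i => ∫ x, coordFn g q i x ∂H₀ with hv
  have h0 : v 0 = H₀.real {star} := by simp [hv, coordFn, integral_starInd]
  have h1 : v 1 = ∫ x, mulExpFn g q x ∂H₀ := by simp [hv, coordFn]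
  have h2 : v 2 = ∫ x, expFn q x ∂H₀ := by simp [hv, coordFn]
  have hp : ∀ i, HasStrictFDerivAt (fun u : Fin 4 → ℝ => u i)
      (ContinuousLinearMap.proj (R := ℝ) (φ := fun _ : Fin 4 => ℝ) i) v :=
    fun i => hasStrictFDerivAt_apply i v
  have hv2 : v 2 ≠ 0 := by rwa [h2]
  have hd := (((hp 1).mul (hp 0)).mul
    ((hasStrictDerivAt_inv hv2).comp_hasStrictFDerivAt v (hp 2))).add (hp 3)
  refine (hd.congr_fderiv ?_).congr_of_eventuallyEq (Eventually.of_forall fun u => ?_)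
  · ext u
    simp [sumCLM, chiWeight, Fin.sum_univ_four, ← h0, ← h1, ← h2]
    field_simp
    ring
  · simp [chiFn, div_eq_mul_inv]

lemma integral_expFn_pos {H₀ : Measure (Obs Y)} [IsProbabilityMeasure H₀] (hH₀ : H₀ {star} < 1)
    (hint : Integrable (expFn q) H₀) : 0 < ∫ x, expFn q x ∂H₀ := by
  rw [integral_pos_iff_support_of_nonneg ?_ hint]
  · have : Function.support (expFn q) = ({star} : Set (Obs Y))ᶜ := by
      ext x
      rcases x with y | u <;> simp [expFn, ext, star, Real.exp_ne_zero]
    rw [this, prob_compl_eq_one_sub measurableSet_star]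
    exact tsub_pos_of_lt hH₀
  · rintro (y | u) <;> simp [expFn, ext, Real.exp_nonneg]

lemma memLp_ext {μ : Measure (Obs Y)} {f G : Y → ℝ} (hf : Measurable f) (hG : Measurable G)
    (hfG : ∀ y, f y ^ 2 ≤ G y) (hint : ∫⁻ x, ENNReal.ofReal (ext G x) ∂μ < ⊤) :
    MemLp (ext f) 2 μ := by
  have hG0 : ∀ x, 0 ≤ ext G x := by
    rintro (y | u)
    · exact (sq_nonneg _).trans (hfG y)
    · exact le_rfl
  have hGi : Integrable (ext G) μ :=
    (lintegral_ofReal_ne_top_iff_integrable (measurable_ext hG).aestronglyMeasurable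
      (ae_of_all _ hG0)).1 hint.ne
  refine (memLp_two_iff_integrable_sq (measurable_ext hf).aestronglyMeasurable).2
    (hGi.mono' ((measurable_ext hf).pow_const 2).aestronglyMeasurable (ae_of_all _ ?_))
  rintro (y | u)
  · simpa [ext] using hfG y
  · simp [ext]

lemma measurable_coordFn (hg : Measurable g) (hq : Measurable q) (i : Fin 4) :
    Measurable (coordFn g q i) := by
  fin_cases i
  · exact measurable_const.indicator measurableSet_star
  · exact measurable_ext (hg.mul hq.exp)
  · exact measurable_ext hq.exp
  · exact measurable_ext hg

lemma memLp_coordFn {μ : Measure (Obs Y)} [IsFiniteMeasure μ] (hg : Measurable g)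
    (hq : Measurable q)
    (hint : ∫⁻ x, ENNReal.ofReal (ext (fun y => g y ^ 2 * Real.exp (2 * q y) + g y ^ 2
      + Real.exp (2 * q y)) x) ∂μ < ⊤) (i : Fin 4) : MemLp (coordFn g q i) 2 μ := by
  have hG : Measurable fun y => g y ^ 2 * Real.exp (2 * q y) + g y ^ 2 + Real.exp (2 * q y) := by
    fun_prop
  have hexp : ∀ y, Real.exp (2 * q y) = Real.exp (q y) ^ 2 := fun y => by
    rw [← Real.exp_nat_mul]
    norm_num
  fin_cases i
  · refine MemLp.of_bound (measurable_coordFn hg hq 0).aestronglyMeasurable 1 (ae_of_all _ ?_)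
    intro x
    change ‖Set.indicator {star} (fun _ => (1 : ℝ)) x‖ ≤ 1
    exact (norm_indicator_le_norm_self _ _).trans (by simp)
  · refine memLp_ext (hg.mul hq.exp) hG (fun y => ?_) hint
    rw [hexp, mul_pow]
    have := sq_nonneg (g y)
    have := sq_nonneg (Real.exp (q y))
    linarith
  · refine memLp_ext hq.exp hG (fun y => ?_) hint
    rw [hexp]
    have := sq_nonneg (g y)
    have : 0 ≤ g y ^ 2 * Real.exp (q y) ^ 2 := by positivity
    linarith
  · refine memLp_ext hg hG (fun y => ?_) hint
    rw [hexp]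
    have := sq_nonneg (Real.exp (q y))
    have : 0 ≤ g y ^ 2 * Real.exp (q y) ^ 2 := by positivity
    linarith

lemma measurable_chi (hg : Measurable g) (hq : Measurable q) :
    Measurable fun H : ProbabilityMeasure (Obs Y) => chi g q (H : Measure (Obs Y)) := by
  simp_rw [chi_eq_chiFn]
  exact measurable_chiFn.comp
    (measurable_pi_lambda _ fun i => measurable_integral_coe (measurable_coordFn hg hq i))

end Obs

/-- `D n x` is the posterior law of `H` given the observations `x 0, …, x (n - 1)`. For fixed `q`
and almost every sequence of observations, the posterior law of `√n (χ(H, q) - χ(ℍₙ, q))` converges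
weakly, in the bounded Lipschitz distance, to a centred normal distribution with an explicit
variance, and this is the law of the stated linear combination of coordinates of every
`H₀`-Brownian bridge. -/
theorem theorem3p1 {Y : Type*} [TopologicalSpace Y] [PolishSpace Y] [MeasurableSpace Y]
    [BorelSpace Y]
    (H₀ : Measure (Obs Y)) [IsProbabilityMeasure H₀] (hH₀ : H₀ {Obs.star} < 1)
    (a : Measure (Obs Y)) [IsFiniteMeasure a]
    (D : (n : ℕ) → (Fin n → Obs Y) → Measure (ProbabilityMeasure (Obs Y)))
    (hD : ∀ n : ℕ, 1 ≤ n → ∀ x : Fin n → Obs Y,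
      IsDirichletProcess (a + (n : ENNReal) • empiricalMeasure x) (D n x))
    (g q : Y → ℝ) (hg : Measurable g) (hq : Measurable q)
    (hint : ∫⁻ x, ENNReal.ofReal (Obs.ext (fun y => g y ^ 2 * Real.exp (2 * q y) + g y ^ 2
      + Real.exp (2 * q y)) x) ∂(H₀ + a) < ⊤) :
    (∀ᵐ x : ℕ → Obs Y ∂(Measure.infinitePi fun _ : ℕ => H₀),
      Tendsto (fun n : ℕ =>
          blDist (Obs.centredLaw g q (fun i : Fin n => x i) (D n fun i : Fin n => x i))
            (gaussianReal 0 (Var[Obs.limitFn g q H₀; H₀]).toNNReal))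
        atTop (𝓝 0)) ∧
    (∀ {Ω : Type*} [MeasurableSpace Ω] (P : Measure Ω) [IsProbabilityMeasure P]
      (B : (Obs Y → ℝ) → Ω → ℝ), IsBrownianBridge H₀ P B →
        HasLaw (Obs.limitVar g q H₀ B) (gaussianReal 0 (Var[Obs.limitFn g q H₀; H₀]).toNNReal) P) := by
  have hmem := Obs.memLp_coordFn (μ := H₀ + a) hg hq hint
  have hH : ∀ i, MemLp (Obs.coordFn g q i) 2 H₀ := fun i => (hmem i).left_of_add_measure
  have ha : ∀ i, MemLp (Obs.coordFn g q i) 2 a := fun i => (hmem i).right_of_add_measure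
  have hmeas := Obs.measurable_coordFn (g := g) (q := q) hg hq
  have hψ : Obs.limitFn g q H₀ = fun x => ∑ i, Obs.chiWeight g q H₀ i * Obs.coordFn g q i x :=
    funext (Obs.limitFn_eq_sum H₀)
  refine ⟨?_, fun {Ω} _ P _ B hB => ?_⟩
  · have hψm : Measurable (Obs.limitFn g q H₀) := by
      rw [hψ]
      exact Finset.measurable_fun_sum _ fun i _ => (hmeas i).const_mul _
    have hψH : MemLp (Obs.limitFn g q H₀) 2 H₀ := by
      rw [hψ]
      exact memLp_finsetSum _ fun i _ => (hH i).const_mul _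
    have hψa : MemLp (Obs.limitFn g q H₀) 2 a := by
      rw [hψ]
      exact memLp_finsetSum _ fun i _ => (ha i).const_mul _
    have hC : ∫ x, Obs.expFn q x ∂H₀ ≠ 0 :=
      (Obs.integral_expFn_pos hH₀ ((hH 2).integrable (by norm_num))).ne'
    filter_upwards [ae_tendsto_integral_exp_scaledError hD hψm hψa hψH,
      ae_all_iff.2 fun i => ae_momentsConverge (hmeas i) (ha i) (hH i)] with x hx hconv
    set Pn : ℕ → Measure (Obs Y) := fun n => empiricalMeasure fun i : Fin n => x i with hPn
    have hpost : IsDirichletPosterior a Pn (fun n => D n fun i => x i) :=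
      ⟨fun n hn => isProbabilityMeasure_empiricalMeasure hn _, fun n hn => hD n hn _⟩
    have hTm : ∀ n : ℕ, Measurable fun H : ProbabilityMeasure (Obs Y) =>
        √(n : ℝ) * (Obs.chi g q (H : Measure (Obs Y)) - Obs.chi g q (Pn n)) := fun n =>
      ((Obs.measurable_chi hg hq).sub_const _).const_mul _
    refine tendsto_blDist_of_tendsto_charFun (fun n hn => ?_) fun t => ?_
    · have := hpost.isProbabilityMeasure hn
      exact Measure.isProbabilityMeasure_map (hTm n).aemeasurable
    · have hdelta := hpost.tendsto_integral_exp_delta hconv Obs.measurable_chiFn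
        (Obs.hasStrictFDerivAt_chiFn H₀ hC) t
      have hsum := hdelta.add (hx t)
      rw [zero_add] at hsum
      have hlim : charFun (gaussianReal 0 (Var[Obs.limitFn g q H₀; H₀]).toNNReal) t
          = Complex.exp (-(t ^ 2 * Var[Obs.limitFn g q H₀; H₀] / 2 : ℝ)) := by
        rw [charFun_gaussianReal, Real.coe_toNNReal _ (variance_nonneg _ _)]
        congr 1
        push_cast
        ring
      rw [hlim]
      refine hsum.congr' ?_
      filter_upwards [eventually_ge_atTop 1] with n hn
      -- The linearized error is the error of the linear functional `limitFn`.
      have hlin : ∀ᵐ H ∂D n fun i => x i, Obs.sumCLM (Obs.chiWeight g q H₀)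
          (fun i => scaledError Pn (Obs.coordFn g q i) n H)
          = scaledError Pn (Obs.limitFn g q H₀) n H := by
        filter_upwards [ae_all_iff.2 fun i => hpost.ae_integrable (hconv i) hn] with H hHi
        rw [Obs.sumCLM_apply, hψ]
        simp only [scaledError]
        rw [integral_finsetSum _ fun i _ => (hHi i).const_mul _, integral_finsetSum _ fun i _ =>
          (integrable_empiricalMeasure (hmeas i) hn _).const_mul _, ← Finset.sum_sub_distrib,
          Finset.mul_sum]
        refine Finset.sum_congr rfl fun i _ => ?_
        rw [integral_const_mul, integral_const_mul]
        ring
      have hcf : charFun (Obs.centredLaw g q (fun i : Fin n => x i) (D n fun i => x i)) t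
          = ∫ H : ProbabilityMeasure (Obs Y), Complex.exp ((t * (√(n : ℝ) *
            (Obs.chi g q (H : Measure (Obs Y)) - Obs.chi g q (Pn n))) : ℝ) * Complex.I)
            ∂(D n fun i => x i) := by
        rw [charFun_apply_real, Obs.centredLaw, integral_map (hTm n).aemeasurable (by fun_prop)]
        simp_rw [Complex.ofReal_mul t]
      have hexp : ∫ H, Complex.exp ((t * Obs.sumCLM (Obs.chiWeight g q H₀)
            (fun i => scaledError Pn (Obs.coordFn g q i) n H) : ℝ) * Complex.I) ∂(D n fun i => x i)
          = ∫ H, Complex.exp ((t * scaledError Pn (Obs.limitFn g q H₀) n H : ℝ) * Complex.I)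
            ∂(D n fun i => x i) :=
        integral_congr_ae (hlin.mono fun H hH => by simp only [hH])
      rw [hcf, hexp, sub_add_cancel]
      simp_rw [Obs.chi_eq_chiFn]
  · have h := hB.hasLaw_sum hH (Obs.chiWeight g q H₀)
    rw [← hψ] at h
    convert h using 2 with ω
    exact Obs.limitVar_eq_sum H₀ B ω
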